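/- Let $N\ge 1$, let $\Omega\subset\mathbb R^N$ be a bounded open set, $2\le p<\infty$ and $q=p/(p-1)$. Let $\alpha,\gamma>0$ and let $\xi_1,\xi_2\in L^\infty(\Omega)\cap BV(\Omega)$ satisfy $0<\alpha\le\xi_1\le\xi_2$ a.e. in $\Omega$. Let $\mathfrak A_{ad}$ be the set of all symmetric matrix functions $A\in L^\infty(\Omega;\mathbb S^N)$ such that $\xi_1^2|\eta|^2\le(\eta,A\eta)\le\xi_2^2|\eta|^2$ a.e. in $\Omega$ for all $\eta\in\mathbb R^N$, $A^{1/2}\in BV(\Omega;\mathbb S^N)$ and $\int_\Omega|DA^{1/2}|:=\sum_{i\le j}\int_\Omega |D(A^{1/2})_{ij}|\le\gamma$. Let $f\in L^2(\Omega)$, and let $(Bu)(x)=\int_\Omega K(x,t)u(t)\,dt$ with $K\in L^p(\Omega\times\Omega)$ be positive as an operator $L^q(\Omega)\to L^p(\Omega)$, i.e. $\int_\Omega (Bu)\,u\,dx\ge0$ for all $u\in L^q(\Omega)$. For each $k\in\mathbb N$ let $\mathcal F_k:[0,\infty)\to[0,\infty)$ be a non-decreasing $C^1$ function with $\mathcal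 F_k(t)=t$ for $0\le t\le k^2$, $\mathcal F_k(t)=k^2+1$ for $t>k^2+1$, and, for some $\delta\in(0,1)$, $t\le\mathcal F_k(t)\le t+\delta$ for $k^2\le t<k^2+1$. Put $$F(y,z)=|y|^{p-2}y+|z|^{p-2}z,\qquad F_{\varepsilon,k}(y,z)=\big[\varepsilon+\mathcal F_k(y^2)\big]^{\frac{p-2}2}y+\big[\varepsilon+\mathcal F_k(z^2)\big]^{\frac{p-2}2}z .$$ For $\varepsilon>0$ and $k\in\mathbb N$ let $\Xi_{\varepsilon,k}$ be the set of all triplets $(A,y,z)$ with $A\in\mathfrak A_{ad}$, $y\in H^1_0(\Omega)$, $z\in L^2(\Omega)$ such that $y$ is a weak solution of $$-\mathrm{div}\Big(\big[\varepsilon+\mathcal F_k(|A^{1/2}\nabla y|^2)\big]^{\frac{p-2}2}A\nabla y\Big)=f\ \text{ in }\Omega$$ and $z+BF_{\varepsilon,k}(y,z)=0$ a.e. in $\Omega$. Let $\varepsilon_n>0$, $\varepsilon_n\to0$, $k_n\in\mathbb N$, $k_n\to\infty$, and let $(A_n,y_n,z_n)\in\Xi_{\varepsilon_n,k_n}$ $\tau_1$-converge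 to $(A_0,y_0,z_0)$, where $A_0\in L^\infty(\Omega;\mathbb S^N)$ is positive semidefinite a.e., $y_0\in H^1_0(\Omega)$ and $z_0\in L^2(\Omega)$; that is, $A_n^{1/2}\rightharpoonup A_0^{1/2}$ weakly-$*$ in $BV(\Omega;\mathbb S^N)$, $y_n\rightharpoonup y_0$ weakly in $H^1_0(\Omega)$ and $z_n\rightharpoonup z_0$ weakly in $L^2(\Omega)$. Then $y_0,z_0\in L^p(\Omega)$ and $z_n\in L^p(\Omega)$ for all $n$, and $$F_{\varepsilon_n,k_n}(y_n,z_n)\rightharpoonup F(y_0,z_0)=|y_0|^{p-2}y_0+|z_0|^{p-2}z_0\ \text{ weakly in }L^q(\Omega),$$ $$z_0+BF(y_0,z_0)=0\ \text{ a.e. in }\Omega,\qquad z_n\to z_0\ \text{ strongly in }L^p(\Omega).$$ -/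

import Mathlib

open MeasureTheory Filter Topology
open scoped ENNReal ContDiff

noncomputable section

namespace Hammerstein

/-- Euclidean space `ℝᴺ`. -/
abbrev E (N : ℕ) : Type := EuclideanSpace ℝ (Fin N)

/-- Lebesgue measure on `Ω`. -/
abbrev leb {N : ℕ} (Ω : Set (E N)) : Measure (E N) := volume.restrict Ω

/-! ### The space `H¹₀(Ω)` -/

/-- `φ ∈ C_c^∞(Ω)`. -/
def IsTestFunction {N : ℕ} (Ω : Set (E N)) (φ : E N → ℝ) : Prop :=
  ContDiff ℝ ∞ φ ∧ HasCompactSupport φ ∧ tsupport φ ⊆ Ω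

/-- `H¹₀(Ω)`: the closure of `C_c^∞(Ω)` for the `H¹` norm.  A function `y ∈ H¹₀(Ω)` is stored
together with its weak gradient, as the pair `(y, ∇y)` in `L²(Ω) × L²(Ω)ᴺ`. -/
def H10 {N : ℕ} (Ω : Set (E N)) :
    Submodule ℝ (Lp ℝ 2 (leb Ω) × Lp (E N) 2 (leb Ω)) :=
  (Submodule.span ℝ {u | ∃ φ : E N → ℝ, IsTestFunction Ω φ ∧
    (u.1 : E N → ℝ) =ᵐ[leb Ω] φ ∧ (u.2 : E N → E N) =ᵐ[leb Ω] gradient φ}).topologicalClosure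

/-- The underlying function of an element of `H¹₀(Ω)`. -/
def val {N : ℕ} {Ω : Set (E N)} (y : H10 Ω) : E N → ℝ := y.1.1

/-- The weak gradient of an element of `H¹₀(Ω)`. -/
def grad {N : ℕ} {Ω : Set (E N)} (y : H10 Ω) : E N → E N := y.1.2

/-! ### Weak convergence -/

/-- Weak convergence `uₙ ⇀ u` in `L^r` of functions in `L^r`, for conjugate exponents
`1 < r, s < ∞`, through the duality pairing of `L^r` with its dual `L^s`. -/
def WeakTendstoLp {X : Type*} [MeasurableSpace X] (μ : Measure X) (r s : ℝ≥0∞)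
    (u : ℕ → X → ℝ) (u₀ : X → ℝ) : Prop :=
  (∀ n, MemLp (u n) r μ) ∧ MemLp u₀ r μ ∧
    ∀ v : X → ℝ, MemLp v s μ →
      Tendsto (fun n => ∫ x, u n x * v x ∂μ) atTop (𝓝 (∫ x, u₀ x * v x ∂μ))

/-- Weak convergence in `H¹₀(Ω)`. -/
def WeakTendstoH10 {N : ℕ} {Ω : Set (E N)} (y : ℕ → H10 Ω) (y₀ : H10 Ω) : Prop :=
  Tendsto (fun n => toWeakSpace ℝ (H10 Ω) (y n)) atTop (𝓝 (toWeakSpace ℝ (H10 Ω) y₀))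

/-! ### Functions of bounded variation -/

/-- `φ ∈ C¹_c(Ω; ℝᴺ)`. -/
def IsC1Field {N : ℕ} (Ω : Set (E N)) (φ : E N → E N) : Prop :=
  ContDiff ℝ 1 φ ∧ HasCompactSupport φ ∧ tsupport φ ⊆ Ω

/-- The divergence of a vector field. -/
def divergence {N : ℕ} (φ : E N → E N) (x : E N) : ℝ :=
  ∑ i, (fderiv ℝ φ x (EuclideanSpace.single i 1)) i

/-- The total variation `∫_Ω |Da|`, i.e. the supremum of `∫_Ω a div φ` over all
`φ ∈ C¹_c(Ω; ℝᴺ)` with `|φ| ≤ 1`. -/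
def variationBV {N : ℕ} (Ω : Set (E N)) (a : E N → ℝ) : ℝ≥0∞ :=
  ⨆ (φ : E N → E N) (_ : IsC1Field Ω φ ∧ ∀ x, ‖φ x‖ ≤ 1),
    ENNReal.ofReal (∫ x in Ω, a x * divergence φ x)

/-- `a ∈ BV(Ω)`. -/
def MemBV {N : ℕ} (Ω : Set (E N)) (a : E N → ℝ) : Prop :=
  IntegrableOn a Ω ∧ variationBV Ω a < ⊤

/-- The finite `ℝᴺ`-valued measure `D` on `Ω` is the distributional derivative of `a`. -/
def IsDerivMeasure {N : ℕ} (Ω : Set (E N)) (a : E N → ℝ) (D : VectorMeasure Ω (E N)) : Prop :=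
  ∀ φ : E N → E N, IsC1Field Ω φ →
    ∫ x in Ω, a x * divergence φ x = - D.integral (fun x : Ω => φ x) (innerSL ℝ)

/-- Weak-`*` convergence in `BV(Ω)`, `Ω` bounded and open: strong convergence in `L¹(Ω)`, and
weak-`*` convergence of the derivatives as measures, i.e. against all `φ ∈ C₀(Ω; ℝᴺ)` (which
are the continuous fields on `ℝᴺ` that vanish off `Ω`). -/
def WeakStarTendstoBV {N : ℕ} (Ω : Set (E N)) (a : ℕ → E N → ℝ) (a₀ : E N → ℝ) : Prop :=
  (∀ n, MemBV Ω (a n)) ∧ MemBV Ω a₀ ∧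
  Tendsto (fun n => ∫ x in Ω, |a n x - a₀ x|) atTop (𝓝 0) ∧
  ∃ (D : ℕ → VectorMeasure Ω (E N)) (D₀ : VectorMeasure Ω (E N)),
    (∀ n, IsDerivMeasure Ω (a n) (D n)) ∧ IsDerivMeasure Ω a₀ D₀ ∧
    ∀ φ : E N → E N, Continuous φ → (∀ x, x ∉ Ω → φ x = 0) →
      Tendsto (fun n => (D n).integral (fun x : Ω => φ x) (innerSL ℝ)) atTop
        (𝓝 (D₀.integral (fun x : Ω => φ x) (innerSL ℝ)))

/-! ### Controls -/

/-- Action of a matrix on a vector. -/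
def act {N : ℕ} (M : Matrix (Fin N) (Fin N) ℝ) (v : E N) : E N :=
  Matrix.toEuclideanCLM (𝕜 := ℝ) M v

open scoped MatrixOrder in
/-- The nonnegative square root `M^{1/2}` of a positive semidefinite symmetric matrix. -/
def msqrt {N : ℕ} (M : Matrix (Fin N) (Fin N) ℝ) : Matrix (Fin N) (Fin N) ℝ := CFC.sqrt M

/-- `A ∈ L^∞(Ω; 𝕊ᴺ)`. -/
def MemLinftySym {N : ℕ} (Ω : Set (E N)) (A : E N → Matrix (Fin N) (Fin N) ℝ) : Prop :=
  (∀ i j, MemLp (fun x => A x i j) ⊤ (leb Ω)) ∧ ∀ᵐ x ∂(leb Ω), (A x).IsSymm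

/-- The class `𝔄_ad` of admissible controls. -/
structure IsAdmissibleControl {N : ℕ} (Ω : Set (E N)) (ξ₁ ξ₂ : E N → ℝ) (γ : ℝ)
    (A : E N → Matrix (Fin N) (Fin N) ℝ) : Prop where
  memLinfty : MemLinftySym Ω A
  bounds : ∀ᵐ x ∂(leb Ω), ∀ η : E N,
    ξ₁ x ^ 2 * ‖η‖ ^ 2 ≤ inner ℝ η (act (A x) η) ∧
      inner ℝ η (act (A x) η) ≤ ξ₂ x ^ 2 * ‖η‖ ^ 2
  sqrt_memBV : ∀ i j, MemBV Ω (fun x => msqrt (A x) i j)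
  variation_le : ∑ i, ∑ j ∈ Finset.Ici i, variationBV Ω (fun x => msqrt (A x) i j) ≤
    ENNReal.ofReal γ

/-! ### The Hammerstein operators and the regularized problem -/

/-- The integral operator `(B u)(x) = ∫_Ω K(x,t) u(t) dt`. -/
def opB {N : ℕ} (Ω : Set (E N)) (K : E N → E N → ℝ) (u : E N → ℝ) (x : E N) : ℝ :=
  ∫ t in Ω, K x t * u t

/-- Positivity of `B : L^q(Ω) → L^p(Ω)`: `⟨Bu, u⟩ ≥ 0` for all `u ∈ L^q(Ω)`. -/
def IsPositiveB {N : ℕ} (Ω : Set (E N)) (q : ℝ) (K : E N → E N → ℝ) : Prop :=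
  ∀ u : E N → ℝ, MemLp u (ENNReal.ofReal q) (leb Ω) → 0 ≤ ∫ x in Ω, opB Ω K u x * u x

/-- `F(y,z) = |y|^{p-2} y + |z|^{p-2} z`, for real numbers `y`, `z`. -/
def nlF (p : ℝ) (y z : ℝ) : ℝ := |y| ^ (p - 2) * y + |z| ^ (p - 2) * z

/-- The conditions on the truncation `𝓕_k : ℝ₊ → ℝ₊`; only its values on `[0, ∞)` matter. -/
structure IsTruncation (k : ℕ) (T : ℝ → ℝ) : Prop where
  mono : MonotoneOn T (Set.Ici 0)
  contDiffOn : ContDiffOn ℝ 1 T (Set.Ici 0)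
  eq_self : ∀ t, 0 ≤ t → t ≤ (k : ℝ) ^ 2 → T t = t
  eq_const : ∀ t, (k : ℝ) ^ 2 + 1 < t → T t = (k : ℝ) ^ 2 + 1
  between : ∃ δ : ℝ, 0 < δ ∧ δ < 1 ∧
    ∀ t, (k : ℝ) ^ 2 ≤ t → t < (k : ℝ) ^ 2 + 1 → t ≤ T t ∧ T t ≤ t + δ

/-- `F_{ε,k}(y,z)` for real numbers `y`, `z`, where `T = 𝓕_k`. -/
def nlFreg (p ε : ℝ) (T : ℝ → ℝ) (y z : ℝ) : ℝ :=
  (ε + T (y ^ 2)) ^ ((p - 2) / 2) * y + (ε + T (z ^ 2)) ^ ((p - 2) / 2) * z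

/-- `y ∈ H¹₀(Ω)` is a weak solution of
`-div ([ε + 𝓕_k(|A^{1/2} ∇y|²)]^{(p-2)/2} A ∇y) = f` in `Ω`. -/
def IsWeakSolution {N : ℕ} (Ω : Set (E N)) (p ε : ℝ) (T : ℝ → ℝ) (f : E N → ℝ)
    (A : E N → Matrix (Fin N) (Fin N) ℝ) (y : H10 Ω) : Prop :=
  ∀ v : H10 Ω,
    ∫ x in Ω, (ε + T (‖act (msqrt (A x)) (grad y x)‖ ^ 2)) ^ ((p - 2) / 2) *
        inner ℝ (act (A x) (grad y x)) (grad v x) =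
      ∫ x in Ω, f x * val v x

/-- `(A, y, z) ∈ Ξ_{ε,k}`: admissible triplets of the regularized problem, `T = 𝓕_k`. -/
structure IsAdmissibleTriplet {N : ℕ} (Ω : Set (E N)) (ξ₁ ξ₂ : E N → ℝ) (γ p : ℝ)
    (f : E N → ℝ) (K : E N → E N → ℝ) (ε : ℝ) (T : ℝ → ℝ)
    (A : E N → Matrix (Fin N) (Fin N) ℝ) (y : H10 Ω) (z : E N → ℝ) : Prop where
  control : IsAdmissibleControl Ω ξ₁ ξ₂ γ A
  z_memLp : MemLp z 2 (leb Ω)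
  state : IsWeakSolution Ω p ε T f A y
  hammerstein : ∀ᵐ x ∂(leb Ω),
    z x + opB Ω K (fun t => nlFreg p ε T (val y t) (z t)) x = 0

/-- `τ₁`-convergence of triplets. -/
structure Tau1Tendsto {N : ℕ} (Ω : Set (E N))
    (A : ℕ → E N → Matrix (Fin N) (Fin N) ℝ) (y : ℕ → H10 Ω) (z : ℕ → E N → ℝ)
    (A₀ : E N → Matrix (Fin N) (Fin N) ℝ) (y₀ : H10 Ω) (z₀ : E N → ℝ) : Prop where
  control : ∀ i j,
    WeakStarTendstoBV Ω (fun n x => msqrt (A n x) i j) (fun x => msqrt (A₀ x) i j)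
  state : WeakTendstoH10 y y₀
  hammerstein : WeakTendstoLp (leb Ω) 2 2 z z₀

end Hammerstein

end

namespace Hammerstein

/-! ### The truncated power `min(|t|, k)^{p-2} t²` -/

/-! The regularized problem has growth `p` only below the level `k`; above it, it is quadratic. What
it controls uniformly is therefore not an `L^p` norm but the modular `∫ min(|u|, k)^{p-2} u²`, and
the estimates have to be carried out on this modular with constants that do not depend on `k`.

Testing the state equation with `yₙ` and using `ξ₁ ≥ α` bounds the modular of `∇yₙ` by `∫ f yₙ`,
which is bounded because `yₙ` converges weakly. A modular Poincaré inequality then bounds the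
modular of `yₙ` (`exists_modular_bound`). Write `Fₙ` for the regularized nonlinearity at `(yₙ, zₙ)`.
Since `zₙ = -B Fₙ`, positivity of `B` says `∫ zₙ Fₙ ≤ 0`, and Young's inequality turns this into a
bound of the modular of `zₙ` by that of `yₙ` (`lintegral_modular_le`). Both modulars together bound
`Fₙ` in `L^q`.

A kernel in `L^p` gives a compact operator, so along a subsequence `zₙ = -B Fₙ` converges strongly
in `L^p`, necessarily to its weak limit `z₀` (`exists_tendsto_kernel`). Translation estimates give
`yₙ → y₀` in `L¹` (`tendsto_eLpNorm_val_sub`). Along a further subsequence both sequences converge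
a.e., hence `Fₙ → F(y₀, z₀)` a.e.; with the `L^q` bound this identifies the weak limit, and the
equation passes to the limit. Fatou's lemma puts `y₀` in `L^p`. All this is
`exists_subseq_hammerstein`; since the limits do not depend on the subsequence, the whole sequence
converges. -/

/-- The truncated power `min(|t|, k)^{p-2} t²`, equal to `|t|^p` for `|t| ≤ k`. -/
noncomputable def truncPow (p k t : ℝ) : ℝ := min |t| k ^ (p - 2) * t ^ 2

section TruncPow

variable {p k : ℝ}

lemma truncPow_nonneg (hk : 0 ≤ k) (t : ℝ) : 0 ≤ truncPow p k t := by
  unfold truncPow; positivity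

lemma measurable_truncPow : Measurable (truncPow p k) := by
  unfold truncPow; fun_prop

lemma truncPow_abs (t : ℝ) : truncPow p k |t| = truncPow p k t := by
  simp [truncPow]

lemma truncPow_mono (hp : 2 ≤ p) (hk : 0 ≤ k) {s t : ℝ} (h : |s| ≤ |t|) :
    truncPow p k s ≤ truncPow p k t := by
  unfold truncPow
  have h2 : s ^ 2 ≤ t ^ 2 := sq_le_sq.2 h
  have h3 : min |s| k ^ (p - 2) ≤ min |t| k ^ (p - 2) :=
    Real.rpow_le_rpow (by positivity) (min_le_min h le_rfl) (by linarith)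
  exact mul_le_mul h3 h2 (by positivity) (by positivity)

lemma truncPow_le_quad (hp : 2 ≤ p) (hk : 0 ≤ k) (t : ℝ) :
    truncPow p k t ≤ k ^ (p - 2) * t ^ 2 := by
  unfold truncPow
  exact mul_le_mul_of_nonneg_right
    (Real.rpow_le_rpow (by positivity) (min_le_right _ _) (by linarith)) (by positivity)

lemma min_abs_mul_le (hk : 0 ≤ k) {c : ℝ} (hc : 1 ≤ c) (t : ℝ) :
    min |c * t| k ≤ c * min |t| k := by
  rw [mul_min_of_nonneg _ _ (by linarith), abs_mul, abs_of_nonneg (by linarith : 0 ≤ c)]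
  exact min_le_min le_rfl (by nlinarith)

lemma weight_mul_le (hp : 2 ≤ p) (hk : 0 ≤ k) {c : ℝ} (hc : 1 ≤ c) (t : ℝ) :
    min |c * t| k ^ (p - 2) ≤ c ^ (p - 2) * min |t| k ^ (p - 2) := by
  rw [← Real.mul_rpow (by linarith) (by positivity)]
  exact Real.rpow_le_rpow (by positivity) (min_abs_mul_le hk hc t) (by linarith)

/-- This is the doubling property of the modular: the constant `c ^ p` does not see `k`, and the
later `k`-independent bounds rest on it. -/
lemma truncPow_mul_le (hp : 2 ≤ p) (hk : 0 ≤ k) {c : ℝ} (hc : 1 ≤ c) (t : ℝ) :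
    truncPow p k (c * t) ≤ c ^ p * truncPow p k t := by
  have h := weight_mul_le hp hk hc t
  have hcp : c ^ p = c ^ (p - 2) * c ^ 2 := by
    rw [← Real.rpow_natCast, ← Real.rpow_add (by linarith)]; norm_num
  unfold truncPow
  calc min |c * t| k ^ (p - 2) * (c * t) ^ 2
      ≤ (c ^ (p - 2) * min |t| k ^ (p - 2)) * (c * t) ^ 2 :=
        mul_le_mul_of_nonneg_right h (by positivity)
    _ = _ := by rw [hcp]; ring

lemma truncPow_add_le (hp : 2 ≤ p) (hk : 0 ≤ k) (s t : ℝ) :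
    truncPow p k (s + t) ≤ 2 ^ p * (truncPow p k s + truncPow p k t) := by
  have h1 := truncPow_nonneg (p := p) hk s
  have h2 := truncPow_nonneg (p := p) hk t
  have h3 : (0 : ℝ) < 2 ^ p := by positivity
  rcases le_total |s| |t| with h | h
  · have : truncPow p k (s + t) ≤ truncPow p k (2 * t) := by
      apply truncPow_mono hp hk
      rw [abs_mul, abs_two]
      exact (abs_add_le s t).trans (by linarith)
    have := truncPow_mul_le hp hk one_le_two t
    nlinarith
  · have : truncPow p k (s + t) ≤ truncPow p k (2 * s) := by
      apply truncPow_mono hp hk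
      rw [abs_mul, abs_two]
      exact (abs_add_le s t).trans (by linarith)
    have := truncPow_mul_le hp hk one_le_two s
    nlinarith

lemma sq_le_truncPow (hp : 2 ≤ p) (hk : 1 ≤ k) {t : ℝ} (ht : 1 ≤ |t|) :
    t ^ 2 ≤ truncPow p k t := by
  unfold truncPow
  have : 1 ≤ min |t| k ^ (p - 2) := Real.one_le_rpow (le_min ht hk) (by linarith)
  nlinarith [sq_nonneg t]

lemma abs_le_one_add_truncPow (hp : 2 ≤ p) (hk : 1 ≤ k) (t : ℝ) :
    |t| ≤ 1 + truncPow p k t := by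
  rcases le_total |t| 1 with h | h
  · have := truncPow_nonneg (p := p) (by linarith : 0 ≤ k) t
    linarith
  · have := sq_le_truncPow hp hk h
    rw [← sq_abs] at this
    nlinarith

/-- A Young inequality with a small constant in front of the first modular. -/
lemma weight_mul_mul_le (hp : 2 ≤ p) (hk : 0 ≤ k) {a s : ℝ} (ha : 0 ≤ a) (hs : 0 ≤ s) :
    min |a| k ^ (p - 2) * a * s ≤ truncPow p k a / 2 + 2 ^ p * truncPow p k s := by
  have hw : 0 ≤ min |a| k ^ (p - 2) := by positivity
  have h2 := truncPow_nonneg (p := p) hk s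
  have h2p : (0 : ℝ) < 2 ^ p := by positivity
  -- Either `s ≤ a / 2`, and the product is at most half of the modular at `a`, or `a < 2 s`, and
  -- everything is dominated by the modular at `2 s`.
  rcases le_total (2 * s) a with h | h
  · have : min |a| k ^ (p - 2) * a * s ≤ truncPow p k a / 2 := by
      unfold truncPow
      nlinarith [mul_nonneg (mul_nonneg hw ha) (sub_nonneg.2 h)]
    nlinarith
  · have h1 : truncPow p k a ≥ 0 := truncPow_nonneg hk a
    have h3 : min |a| k ^ (p - 2) ≤ min |2 * s| k ^ (p - 2) :=
      Real.rpow_le_rpow (by positivity)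
        (min_le_min (by rw [abs_of_nonneg ha, abs_of_nonneg (by linarith)]; exact h) le_rfl)
        (by linarith)
    have h4 : min |a| k ^ (p - 2) * a * s ≤ truncPow p k (2 * s) := by
      unfold truncPow
      calc min |a| k ^ (p - 2) * a * s ≤ min |2 * s| k ^ (p - 2) * (2 * s) * (2 * s) := by
            gcongr; linarith
        _ = _ := by ring
    linarith [truncPow_mul_le hp hk one_le_two s]

end TruncPow

/-! ### The regularized nonlinearity -/

/-- The weight `[ε + 𝓕_k(t²)]^{(p-2)/2}`. -/
noncomputable def regWeight (p ε : ℝ) (T : ℝ → ℝ) (t : ℝ) : ℝ := (ε + T (t ^ 2)) ^ ((p - 2) / 2)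

section Truncation

variable {k : ℕ} {T : ℝ → ℝ}

lemma IsTruncation.le_add_one (hT : IsTruncation k T) {t : ℝ} (ht : 0 ≤ t) : T t ≤ t + 1 := by
  rcases le_or_gt t ((k : ℝ) ^ 2) with h | h
  · linarith [hT.eq_self t ht h]
  rcases lt_or_ge t ((k : ℝ) ^ 2 + 1) with h' | h'
  · obtain ⟨δ, -, hδ, H⟩ := hT.between
    linarith [(H t h.le h').2]
  -- The endpoint `t = k² + 1` is covered neither by `between` nor by `eq_const`; monotonicity and a
  -- point strictly beyond it give the value.
  · have h1 : T t ≤ T (t + 1) := hT.mono ht (Set.mem_Ici.2 (by linarith)) (by linarith)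
    have := hT.eq_const (t + 1) (by linarith)
    linarith

lemma IsTruncation.le_const (hT : IsTruncation k T) {t : ℝ} (ht : 0 ≤ t) :
    T t ≤ (k : ℝ) ^ 2 + 1 := by
  have hk : 0 ≤ (k : ℝ) ^ 2 := by positivity
  have h1 : T t ≤ T (t + ((k : ℝ) ^ 2 + 2)) :=
    hT.mono ht (Set.mem_Ici.2 (by linarith)) (by linarith)
  rwa [hT.eq_const (t + ((k : ℝ) ^ 2 + 2)) (by linarith)] at h1

lemma IsTruncation.min_le (hT : IsTruncation k T) {t : ℝ} (ht : 0 ≤ t) :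
    min t ((k : ℝ) ^ 2) ≤ T t := by
  have hm : 0 ≤ min t ((k : ℝ) ^ 2) := le_min ht (by positivity)
  rw [← hT.eq_self _ hm (min_le_right _ _)]
  exact hT.mono hm ht (min_le_left _ _)

lemma IsTruncation.nonneg (hT : IsTruncation k T) {t : ℝ} (ht : 0 ≤ t) : 0 ≤ T t :=
  (le_min ht (by positivity)).trans (hT.min_le ht)

lemma IsTruncation.continuous_comp {X : Type*} [TopologicalSpace X] (hT : IsTruncation k T)
    {g : X → ℝ} (hg : Continuous g) (h0 : ∀ x, 0 ≤ g x) : Continuous fun x => T (g x) :=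
  hT.contDiffOn.continuousOn.comp_continuous hg h0

variable {p ε : ℝ}

lemma regWeight_nonneg (hT : IsTruncation k T) (hε : 0 < ε) (t : ℝ) :
    0 ≤ regWeight p ε T t := by
  have := hT.nonneg (sq_nonneg t)
  unfold regWeight; positivity

lemma regWeight_le_const (hT : IsTruncation k T) (hε : 0 < ε) (hp : 2 ≤ p) (t : ℝ) :
    regWeight p ε T t ≤ (ε + ((k : ℝ) ^ 2 + 1)) ^ ((p - 2) / 2) := by
  have := hT.nonneg (sq_nonneg t)
  exact Real.rpow_le_rpow (by positivity) (by linarith [hT.le_const (sq_nonneg t)]) (by linarith)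

lemma regWeight_mono (hT : IsTruncation k T) (hε : 0 < ε) (hp : 2 ≤ p) {s t : ℝ}
    (h : |s| ≤ |t|) : regWeight p ε T s ≤ regWeight p ε T t := by
  have := hT.nonneg (sq_nonneg s)
  refine Real.rpow_le_rpow (by positivity) ?_ (by linarith)
  have := hT.mono (Set.mem_Ici.2 (sq_nonneg s)) (Set.mem_Ici.2 (sq_nonneg t)) (sq_le_sq.2 h)
  linarith

lemma continuous_regWeight (hT : IsTruncation k T) (hp : 2 ≤ p) :
    Continuous (regWeight p ε T) := by
  unfold regWeight
  exact (continuous_const.add (hT.continuous_comp (by fun_prop) fun t => sq_nonneg t)).rpow_const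
    fun _ => Or.inr (by linarith)

/-- A Young inequality from monotonicity of the weight: if `2|s| ≤ |t|`, replace the weight at `s`
by that at `t`; otherwise bound `|t|` by `2|s|`. The factor `1/2` on the `t` term allows it to be
absorbed later. -/
lemma regWeight_mul_mul_le (hT : IsTruncation k T) (hε : 0 < ε) (hp : 2 ≤ p) (s t : ℝ) :
    |regWeight p ε T s * s * t| ≤
      regWeight p ε T t * t ^ 2 / 2 + 2 * (regWeight p ε T s * s ^ 2) := by
  have hs := regWeight_nonneg (p := p) hT hε s
  have ht := regWeight_nonneg (p := p) hT hε t
  rw [abs_mul, abs_mul, abs_of_nonneg hs, ← sq_abs t, ← sq_abs s]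
  have as := abs_nonneg s
  have at' := abs_nonneg t
  rcases le_total (2 * |s|) |t| with h | h
  · have hw := regWeight_mono (p := p) hT hε hp (by linarith : |s| ≤ |t|)
    have : regWeight p ε T s * |s| * |t| ≤ regWeight p ε T t * |s| * |t| := by gcongr
    nlinarith [mul_nonneg (mul_nonneg ht at') (sub_nonneg.2 h), mul_nonneg hs (sq_nonneg |s|)]
  · nlinarith [mul_nonneg (mul_nonneg hs as) (sub_nonneg.2 h), mul_nonneg ht (sq_nonneg |t|)]

lemma truncPow_le_regWeight (hT : IsTruncation k T) (hε : 0 < ε) (hp : 2 ≤ p) (t : ℝ) :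
    truncPow p k t ≤ regWeight p ε T t * t ^ 2 := by
  unfold truncPow regWeight
  refine mul_le_mul_of_nonneg_right ?_ (sq_nonneg t)
  have hm : 0 ≤ min |t| (k : ℝ) := by positivity
  have h1 : min |t| (k : ℝ) ^ (p - 2) = (min |t| (k : ℝ) ^ 2) ^ ((p - 2) / 2) := by
    rw [← Real.rpow_natCast, ← Real.rpow_mul hm]; congr 1; push_cast; ring
  rw [h1]
  refine Real.rpow_le_rpow (by positivity) ?_ (by linarith)
  have h2 : min |t| (k : ℝ) ^ 2 ≤ min (t ^ 2) ((k : ℝ) ^ 2) := by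
    refine le_min ?_ ?_
    · rw [← sq_abs t]; gcongr; exact min_le_left _ _
    · gcongr; exact min_le_right _ _
  linarith [hT.min_le (sq_nonneg t)]

/-- With `truncPow_le_regWeight`, this makes the two modulars comparable up to an additive constant.
The `3` comes from `ε ≤ 1` and `T (t²) ≤ min (t² + 1) (k² + 1)`: the base is at most `3` for `|t| ≤
1`, and at most `3 min(|t|, k)²` once `|t|` and `k` are at least `1`. -/
lemma regWeight_le_truncPow (hT : IsTruncation k T) (hε : 0 < ε) (hε1 : ε ≤ 1) (hk : 1 ≤ k)
    (hp : 2 ≤ p) (t : ℝ) :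
    regWeight p ε T t * t ^ 2 ≤ 3 ^ ((p - 2) / 2) * (1 + truncPow p k t) := by
  have hk' : (1 : ℝ) ≤ k := by exact_mod_cast hk
  have hT0 := hT.nonneg (sq_nonneg t)
  have h3 : (0 : ℝ) < 3 ^ ((p - 2) / 2) := by positivity
  have h0 := truncPow_nonneg (p := p) (by linarith : (0 : ℝ) ≤ k) t
  rcases le_total |t| 1 with h | h
  · have h1 := (sq_le_one_iff_abs_le_one t).2 h
    have : regWeight p ε T t ≤ 3 ^ ((p - 2) / 2) := by
      refine Real.rpow_le_rpow (by positivity) ?_ (by linarith)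
      linarith [hT.le_add_one (sq_nonneg t)]
    calc regWeight p ε T t * t ^ 2 ≤ 3 ^ ((p - 2) / 2) * 1 := by gcongr
      _ ≤ _ := by gcongr; linarith
  · have hm : 1 ≤ min |t| (k : ℝ) := le_min h hk'
    have h1 : min |t| (k : ℝ) ^ (p - 2) = (min |t| (k : ℝ) ^ 2) ^ ((p - 2) / 2) := by
      rw [← Real.rpow_natCast, ← Real.rpow_mul (by linarith)]; congr 1; push_cast; ring
    have h4 : regWeight p ε T t ≤ 3 ^ ((p - 2) / 2) * min |t| (k : ℝ) ^ (p - 2) := by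
      rw [h1, ← Real.mul_rpow (by norm_num) (by positivity)]
      refine Real.rpow_le_rpow (by positivity) ?_ (by linarith)
      have h5 := hT.le_add_one (sq_nonneg t)
      have h6 := hT.le_const (sq_nonneg t)
      rcases min_choice |t| (k : ℝ) with h7 | h7 <;> rw [h7] at hm ⊢
      · rw [sq_abs]; nlinarith [sq_abs t]
      · nlinarith
    calc regWeight p ε T t * t ^ 2 ≤ 3 ^ ((p - 2) / 2) * min |t| (k : ℝ) ^ (p - 2) * t ^ 2 := by
          gcongr
      _ = 3 ^ ((p - 2) / 2) * truncPow p k t := by unfold truncPow; ring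
      _ ≤ _ := by gcongr; linarith

/-- With `w` the weight, `(w|t|)^q = w^{q-1} · w|t|^q`. For `|t| ≥ 1` the weight is at most a
constant times `|t|^{p-2}`, and `(p-2)(q-1) = 2-q`, so the extra factor raises `|t|^q` exactly to
`t²`. Hence the modular bounds the nonlinearity in `L^q`, uniformly in `k`. -/
lemma abs_regWeight_mul_rpow_le (hT : IsTruncation k T) (hε : 0 < ε) (hε1 : ε ≤ 1)
    (hp : 2 ≤ p) {q : ℝ} (hq : q = p / (p - 1)) (t : ℝ) :
    |regWeight p ε T t * t| ^ q ≤ (3 ^ ((p - 2) / 2)) ^ q * (1 + regWeight p ε T t * t ^ 2) := by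
  have hT0 := hT.nonneg (sq_nonneg t)
  have hw := regWeight_nonneg (p := p) hT hε t
  have hq1 : 1 ≤ q := by rw [hq, le_div_iff₀ (by linarith)]; linarith
  have h3 : (1 : ℝ) ≤ 3 ^ ((p - 2) / 2) := Real.one_le_rpow (by norm_num) (by linarith)
  have h3q : (0 : ℝ) < (3 ^ ((p - 2) / 2)) ^ q := by positivity
  rw [abs_mul, abs_of_nonneg hw]
  have hP : 0 ≤ regWeight p ε T t * t ^ 2 := by positivity
  rcases le_total |t| 1 with h | h
  · have h1 := (sq_le_one_iff_abs_le_one t).2 h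
    have : regWeight p ε T t ≤ 3 ^ ((p - 2) / 2) := by
      refine Real.rpow_le_rpow (by positivity) ?_ (by linarith)
      linarith [hT.le_add_one (sq_nonneg t)]
    calc (regWeight p ε T t * |t|) ^ q ≤ (3 ^ ((p - 2) / 2) * 1) ^ q := by gcongr
      _ = (3 ^ ((p - 2) / 2)) ^ q * 1 := by ring_nf
      _ ≤ _ := by gcongr; linarith
  · have ht0 : 0 < |t| := by linarith
    have h4 : regWeight p ε T t ≤ 3 ^ ((p - 2) / 2) * |t| ^ (p - 2) := by
      have h1 : |t| ^ (p - 2) = (|t| ^ 2) ^ ((p - 2) / 2) := by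
        rw [← Real.rpow_natCast, ← Real.rpow_mul (by linarith)]; congr 1; push_cast; ring
      rw [h1, ← Real.mul_rpow (by norm_num) (by positivity)]
      refine Real.rpow_le_rpow (by positivity) ?_ (by linarith)
      have h5 := hT.le_add_one (sq_nonneg t)
      rw [sq_abs]; nlinarith [sq_abs t]
    have hqe : (p - 2) * (q - 1) = 2 - q := by
      rw [hq]; field_simp [(by linarith : p - 1 ≠ 0)]; ring
    have h5 : regWeight p ε T t ^ (q - 1) ≤ (3 ^ ((p - 2) / 2)) ^ q * |t| ^ (2 - q) := by
      calc regWeight p ε T t ^ (q - 1) ≤ (3 ^ ((p - 2) / 2) * |t| ^ (p - 2)) ^ (q - 1) :=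
            Real.rpow_le_rpow hw h4 (by linarith)
        _ = (3 ^ ((p - 2) / 2)) ^ (q - 1) * |t| ^ (2 - q) := by
            rw [Real.mul_rpow (by positivity) (by positivity), ← Real.rpow_mul ht0.le, hqe]
        _ ≤ _ := by
            gcongr
            · linarith
    have h6 : 0 < regWeight p ε T t := by unfold regWeight; positivity
    calc (regWeight p ε T t * |t|) ^ q
        = regWeight p ε T t ^ (q - 1) * (regWeight p ε T t * |t| ^ q) := by
          rw [Real.mul_rpow hw ht0.le, ← mul_assoc, ← Real.rpow_add_one h6.ne']; ring_nf
      _ ≤ (3 ^ ((p - 2) / 2)) ^ q * |t| ^ (2 - q) * (regWeight p ε T t * |t| ^ q) := by gcongr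
      _ = (3 ^ ((p - 2) / 2)) ^ q * (regWeight p ε T t * (|t| ^ (2 - q) * |t| ^ q)) := by ring
      _ = (3 ^ ((p - 2) / 2)) ^ q * (regWeight p ε T t * t ^ 2) := by
          rw [← Real.rpow_add ht0, ← sq_abs t, ← Real.rpow_natCast]; norm_num
      _ ≤ _ := by gcongr; linarith

end Truncation

/-- Convergence of the regularized nonlinearity along a convergent sequence. -/
lemma tendsto_regWeight {p : ℝ} (hp : 2 ≤ p) {ε : ℕ → ℝ} (hε : Tendsto ε atTop (𝓝 0))
    {k : ℕ → ℕ} (hk : Tendsto k atTop atTop) {T : ℕ → ℝ → ℝ}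
    (hT : ∀ n, IsTruncation (k n) (T n)) {s : ℕ → ℝ} {t : ℝ} (hs : Tendsto s atTop (𝓝 t)) :
    Tendsto (fun n => regWeight p (ε n) (T n) (s n)) atTop (𝓝 (|t| ^ (p - 2))) := by
  have h1 : |t| ^ (p - 2) = (0 + t ^ 2) ^ ((p - 2) / 2) := by
    rw [zero_add, ← sq_abs, ← Real.rpow_natCast, ← Real.rpow_mul (abs_nonneg t)]
    congr 1; push_cast; ring
  rw [h1]
  have h2 : Tendsto (fun n => (ε n + s n ^ 2) ^ ((p - 2) / 2)) atTop
      (𝓝 ((0 + t ^ 2) ^ ((p - 2) / 2))) :=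
    (hε.add (hs.pow 2)).rpow_const (Or.inr (by linarith))
  refine h2.congr' ?_
  have h3 : ∀ᶠ n in atTop, s n ^ 2 < t ^ 2 + 1 :=
    (hs.pow 2).eventually_lt_const (by linarith)
  -- Once `k n ≥ m + 1`, the values `s n ^ 2` lie below `(k n)²`, where the truncation is the
  -- identity.
  obtain ⟨m, hm⟩ := exists_nat_gt (t ^ 2 + 1)
  filter_upwards [h3, hk.eventually_ge_atTop (m + 1)] with n hn hkn
  have hkn' : (m : ℝ) + 1 ≤ k n := by exact_mod_cast hkn
  have hm0 : (0 : ℝ) ≤ m := by positivity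
  rw [regWeight, (hT n).eq_self _ (sq_nonneg _) (by nlinarith)]


/-! ### Inequalities for smooth functions -/

/-- Jensen's inequality for the truncated power, up to a constant. -/
lemma truncPow_le_integral {p k : ℝ} (hp : 2 ≤ p) (hk : 0 ≤ k) {X : Type*} [MeasurableSpace X]
    (ν : Measure X) [IsProbabilityMeasure ν] {s : X → ℝ} (hs0 : ∀ x, 0 ≤ s x)
    (hs : Integrable s ν) (hs' : Integrable (fun x => truncPow p k (s x)) ν) {a : ℝ}
    (ha : 0 ≤ a) (has : a ≤ ∫ x, s x ∂ν) :
    truncPow p k a ≤ 2 ^ (p + 1) * ∫ x, truncPow p k (s x) ∂ν := by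
  -- For `p > 2` and `k > 0` the truncated power is not convex (its slope drops at `|t| = k`), so
  -- Jensen's inequality does not apply. Instead, one factor `a` is replaced by the mean of `s`,
  -- Young is applied under the integral, and half of the left side is absorbed.
  have hw : 0 ≤ min |a| k ^ (p - 2) * a := by positivity
  have h1 : truncPow p k a ≤ ∫ x, min |a| k ^ (p - 2) * a * s x ∂ν := by
    rw [integral_const_mul]
    calc truncPow p k a = min |a| k ^ (p - 2) * a * a := by unfold truncPow; ring
      _ ≤ _ := mul_le_mul_of_nonneg_left has hw
  have h2 : ∫ x, min |a| k ^ (p - 2) * a * s x ∂ν ≤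
      ∫ x, (truncPow p k a / 2 + 2 ^ p * truncPow p k (s x)) ∂ν :=
    integral_mono (hs.const_mul _) ((integrable_const _).add (hs'.const_mul _))
      fun x => weight_mul_mul_le hp hk ha (hs0 x)
  rw [integral_add (integrable_const _) (hs'.const_mul _), integral_const_mul _ (fun x => truncPow p k (s x))] at h2
  simp only [integral_const, probReal_univ, one_smul] at h2
  rw [Real.rpow_add (by norm_num), Real.rpow_one]
  linarith

section Smooth

variable {N : ℕ}

lemma norm_gradient (φ : E N → ℝ) (x : E N) : ‖gradient φ x‖ = ‖fderiv ℝ φ x‖ := by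
  unfold gradient; exact LinearIsometryEquiv.norm_map _ _

lemma continuous_gradient {φ : E N → ℝ} (hφ : ContDiff ℝ ∞ φ) : Continuous (gradient φ) := by
  unfold gradient
  exact (LinearIsometryEquiv.continuous _).comp (hφ.continuous_fderiv (by simp))

lemma tsupport_gradient_subset (φ : E N → ℝ) {x : E N} (hx : x ∉ tsupport φ) :
    gradient φ x = 0 := by
  have : fderiv ℝ φ x = 0 := by
    by_contra h
    exact hx (support_fderiv_subset ℝ h)
  unfold gradient; simp [this]

lemma abs_sub_le_integral {φ : E N → ℝ} (hφ : ContDiff ℝ ∞ φ) (x h : E N) :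
    |φ (x + h) - φ x| ≤ ‖h‖ * ∫ t in Set.Ioc (0 : ℝ) 1, ‖gradient φ (x + t • h)‖ := by
  have hd : ∀ t : ℝ, HasDerivAt (fun t : ℝ => φ (x + t • h)) (fderiv ℝ φ (x + t • h) h) t := by
    intro t
    have h1 : HasFDerivAt φ (fderiv ℝ φ (x + t • h)) (x + t • h) :=
      ((hφ.differentiable (by simp)) _).hasFDerivAt
    have h2 : HasDerivAt (fun t : ℝ => x + t • h) h t := by
      simpa using ((hasDerivAt_id t).smul_const h).const_add x
    exact h1.comp_hasDerivAt t h2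
  have hc : Continuous fun t : ℝ => fderiv ℝ φ (x + t • h) h :=
    ((hφ.continuous_fderiv (by simp)).comp (by fun_prop)).clm_apply continuous_const
  have h3 := intervalIntegral.integral_eq_sub_of_hasDerivAt (a := 0) (b := 1)
    (fun t _ => hd t) (hc.intervalIntegrable 0 1)
  simp only [one_smul, zero_smul, add_zero] at h3
  rw [← h3, intervalIntegral.integral_of_le zero_le_one, ← integral_const_mul,
    ← Real.norm_eq_abs]
  refine (norm_integral_le_integral_norm _).trans (integral_mono_of_nonneg
    (Eventually.of_forall fun _ => norm_nonneg _) ?_ (Eventually.of_forall fun t => ?_))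
  · have : Continuous fun t : ℝ => ‖h‖ * ‖gradient φ (x + t • h)‖ :=
      continuous_const.mul ((continuous_gradient hφ).comp (by fun_prop)).norm
    exact (this.integrableOn_Icc (a := 0) (b := 1)).mono_set Set.Ioc_subset_Icc_self
  · dsimp only
    rw [norm_gradient, mul_comm]
    exact ContinuousLinearMap.le_opNorm _ _

/-- Averaging translates does not change the integral. -/
lemma lintegral_segment_translate {G : E N → ℝ≥0∞} (hG : Measurable G) (h : E N) :
    ∫⁻ x, ∫⁻ t in Set.Ioc (0 : ℝ) 1, G (x + t • h) = ∫⁻ x, G x := by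
  rw [lintegral_lintegral_swap]
  · simp_rw [lintegral_add_right_eq_self G]
    simp
  · refine Measurable.aemeasurable ?_
    simp only [Function.uncurry_def]
    exact hG.comp (by fun_prop)

lemma lintegral_translate_sub_le {φ : E N → ℝ} (hφ : ContDiff ℝ ∞ φ) (h : E N) :
    ∫⁻ x, ‖φ (x + h) - φ x‖ₑ ≤ ‖h‖ₑ * ∫⁻ x, ‖gradient φ x‖ₑ := by
  have hc := continuous_gradient hφ
  rw [← lintegral_segment_translate (G := fun x => ‖gradient φ x‖ₑ) hc.enorm.measurable h,
    ← lintegral_const_mul']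
  swap
  · simp
  refine lintegral_mono fun x => ?_
  have h1 := abs_sub_le_integral hφ x h
  have hint : IntegrableOn (fun t : ℝ => gradient φ (x + t • h)) (Set.Ioc 0 1) := by
    have : Continuous fun t : ℝ => gradient φ (x + t • h) := hc.comp (by fun_prop)
    exact (this.integrableOn_Icc (a := 0) (b := 1)).mono_set Set.Ioc_subset_Icc_self
  rw [← ofReal_integral_norm_eq_lintegral_enorm hint, ← ofReal_norm h,
    ← ENNReal.ofReal_mul (norm_nonneg _), ← ofReal_norm]
  exact ENNReal.ofReal_le_ofReal h1

lemma continuous_truncPow {p k : ℝ} (hp : 2 ≤ p) : Continuous (truncPow p k) := by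
  unfold truncPow
  exact ((continuous_abs.min continuous_const).rpow_const fun _ => Or.inr (by linarith)).mul
    (by fun_prop)

/-- The modular Poincaré inequality for smooth functions supported in `Ω`, when the translation
by `h` moves `Ω` off itself. -/
lemma lintegral_truncPow_div_le {p k : ℝ} (hp : 2 ≤ p) (hk : 0 ≤ k) {Ω : Set (E N)}
    {φ : E N → ℝ} (hφ : IsTestFunction Ω φ) {h : E N} (hh : h ≠ 0)
    (hΩh : ∀ x ∈ Ω, x + h ∉ Ω) :
    ∫⁻ x, ENNReal.ofReal (truncPow p k (φ x / ‖h‖)) ≤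
      ENNReal.ofReal (2 ^ (p + 1)) * ∫⁻ x, ENNReal.ofReal (truncPow p k ‖gradient φ x‖) := by
  have hc := continuous_gradient hφ.1
  have hG : Continuous fun x => truncPow p k ‖gradient φ x‖ :=
    (continuous_truncPow hp).comp hc.norm
  rw [← lintegral_segment_translate
    (G := fun x => ENNReal.ofReal (truncPow p k ‖gradient φ x‖))
      hG.measurable.ennreal_ofReal h,
    ← lintegral_const_mul' _ _ (by simp)]
  refine lintegral_mono fun x => ?_
  -- For `x ∈ Ω` the point `x + h` lies outside `Ω`, so `φ (x + h) = 0` and `|φ x| / ‖h‖` is bounded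
  -- by the mean of the gradient norm on the segment.
  by_cases hx : x ∈ Ω
  · have hline : Continuous fun t : ℝ => gradient φ (x + t • h) := hc.comp (by fun_prop)
    have hint : IntegrableOn (fun t : ℝ => ‖gradient φ (x + t • h)‖) (Set.Ioc 0 1) :=
      (hline.norm.integrableOn_Icc (a := 0) (b := 1)).mono_set Set.Ioc_subset_Icc_self
    have hint' : IntegrableOn (fun t : ℝ => truncPow p k ‖gradient φ (x + t • h)‖)
        (Set.Ioc 0 1) :=
      (((continuous_truncPow hp).comp hline.norm).integrableOn_Icc (a := 0) (b := 1)).mono_set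
        Set.Ioc_subset_Icc_self
    have hprob : IsProbabilityMeasure (volume.restrict (Set.Ioc (0 : ℝ) 1)) := ⟨by simp⟩
    have h1 := abs_sub_le_integral hφ.1 x h
    have h0 : φ (x + h) = 0 := by
      by_contra h0
      exact hΩh x hx (hφ.2.2 (subset_tsupport φ h0))
    have hh' : 0 < ‖h‖ := norm_pos_iff.2 hh
    rw [h0, zero_sub, abs_neg, mul_comm, ← div_le_iff₀ hh'] at h1
    have h2 := truncPow_le_integral hp hk _ (fun t => norm_nonneg _) hint hint'
      (by positivity) h1
    rw [show |φ x| / ‖h‖ = |φ x / ‖h‖| by rw [abs_div, abs_norm], truncPow_abs] at h2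
    rw [← ofReal_integral_eq_lintegral_ofReal hint'
      (Eventually.of_forall fun t => truncPow_nonneg hk _), ← ENNReal.ofReal_mul (by positivity)]
    exact ENNReal.ofReal_le_ofReal h2
  · have h0 : φ x = 0 := by
      by_contra h0
      exact hx (hφ.2.2 (subset_tsupport φ h0))
    simp [h0, truncPow]

end Smooth


/-! ### Extension to `H¹₀(Ω)` by density -/

section Sobolev

variable {N : ℕ} {Ω : Set (E N)}

lemma stronglyMeasurable_val (u : H10 Ω) : StronglyMeasurable (val u) :=
  Lp.stronglyMeasurable u.1.1

lemma stronglyMeasurable_grad (u : H10 Ω) : StronglyMeasurable (grad u) :=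
  Lp.stronglyMeasurable u.1.2

lemma memLp_val (u : H10 Ω) : MemLp (val u) 2 (leb Ω) := Lp.memLp u.1.1

lemma memLp_grad (u : H10 Ω) : MemLp (grad u) 2 (leb Ω) := Lp.memLp u.1.2

lemma val_sub (u v : H10 Ω) : val (u - v) =ᵐ[leb Ω] fun x => val u x - val v x :=
  Lp.coeFn_sub u.1.1 v.1.1

lemma grad_sub (u v : H10 Ω) : grad (u - v) =ᵐ[leb Ω] fun x => grad u x - grad v x :=
  Lp.coeFn_sub u.1.2 v.1.2

/-- Test functions already form a subspace, so the span in `H10` adds nothing and its closure is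
reached by sequences of genuine test functions. -/
lemma exists_testFunction_of_mem_span {u : Lp ℝ 2 (leb Ω) × Lp (E N) 2 (leb Ω)}
    (hu : u ∈ Submodule.span ℝ {u : Lp ℝ 2 (leb Ω) × Lp (E N) 2 (leb Ω) |
      ∃ φ : E N → ℝ, IsTestFunction Ω φ ∧
        (u.1 : E N → ℝ) =ᵐ[leb Ω] φ ∧ (u.2 : E N → E N) =ᵐ[leb Ω] gradient φ}) :
    ∃ φ : E N → ℝ, IsTestFunction Ω φ ∧
      (u.1 : E N → ℝ) =ᵐ[leb Ω] φ ∧ (u.2 : E N → E N) =ᵐ[leb Ω] gradient φ := by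
  induction hu using Submodule.span_induction with
  | mem u hu => exact hu
  | zero =>
    refine ⟨fun _ => 0, ⟨contDiff_const, HasCompactSupport.zero, ?_⟩, ?_, ?_⟩
    · simp [tsupport]
    · exact Lp.coeFn_zero _ _ _
    · rw [gradient_fun_const']
      exact Lp.coeFn_zero _ _ _
  | add u v _ _ hu hv =>
    obtain ⟨φ, ⟨h1, h2, h3⟩, h4, h5⟩ := hu
    obtain ⟨ψ, ⟨g1, g2, g3⟩, g4, g5⟩ := hv
    refine ⟨φ + ψ, ⟨h1.add g1, h2.add g2, ?_⟩, ?_, ?_⟩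
    · exact (tsupport_add φ ψ).trans (Set.union_subset h3 g3)
    · exact (Lp.coeFn_add u.1 v.1).trans (h4.add g4)
    · refine (Lp.coeFn_add u.2 v.2).trans ((h5.add g5).trans (Eventually.of_forall fun x => ?_))
      simp only [gradient, Pi.add_apply]
      rw [fderiv_add (h1.differentiable (by simp) x) (g1.differentiable (by simp) x), map_add]
  | smul c u _ hu =>
    obtain ⟨φ, ⟨h1, h2, h3⟩, h4, h5⟩ := hu
    refine ⟨c • φ, ⟨h1.const_smul c, h2.smul_left (f := fun _ => c), ?_⟩, ?_, ?_⟩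
    · exact (closure_mono (Function.support_const_smul_subset c φ)).trans h3
    · exact (Lp.coeFn_smul c u.1).trans (h4.const_smul c)
    · refine (Lp.coeFn_smul c u.2).trans
        ((h5.const_smul c).trans (Eventually.of_forall fun x => ?_))
      simp only [gradient, Pi.smul_apply]
      rw [fderiv_const_smul (h1.differentiable (by simp) x), map_smulₛₗ]
      simp

/-- Elements of `H¹₀(Ω)` are limits of test functions. -/
lemma exists_testFunction_seq (u : H10 Ω) :
    ∃ φ : ℕ → E N → ℝ, (∀ n, IsTestFunction Ω (φ n)) ∧
      Tendsto (fun n => eLpNorm (fun x => φ n x - val u x) 2 (leb Ω)) atTop (𝓝 0) ∧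
      Tendsto (fun n => eLpNorm (fun x => gradient (φ n) x - grad u x) 2 (leb Ω)) atTop (𝓝 0) := by
  obtain ⟨u, hu⟩ := u
  have hu' := hu
  rw [H10, ← SetLike.mem_coe, Submodule.topologicalClosure_coe, mem_closure_iff_seq_limit] at hu'
  obtain ⟨w, hw, hlim⟩ := hu'
  choose φ hφ h1 h2 using fun n => exists_testFunction_of_mem_span (hw n)
  refine ⟨φ, hφ, ?_, ?_⟩
  · have := (Lp.tendsto_Lp_iff_tendsto_eLpNorm' _ _).1 ((continuous_fst.tendsto _).comp hlim)
    refine this.congr fun n => eLpNorm_congr_ae ?_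
    filter_upwards [h1 n] with x hx
    simp only [Pi.sub_apply, Function.comp_apply, hx]
    rfl
  · have := (Lp.tendsto_Lp_iff_tendsto_eLpNorm' _ _).1 ((continuous_snd.tendsto _).comp hlim)
    refine this.congr fun n => eLpNorm_congr_ae ?_
    filter_upwards [h2 n] with x hx
    simp only [Pi.sub_apply, Function.comp_apply, hx]
    rfl

lemma lintegral_enorm_sq_eq {X F : Type*} [MeasurableSpace X] [NormedAddCommGroup F]
    (μ : Measure X) (f : X → F) : ∫⁻ x, ‖f x‖ₑ ^ 2 ∂μ = eLpNorm f 2 μ ^ 2 := by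
  have := eLpNorm_nnreal_pow_eq_lintegral (f := f) (μ := μ) (p := 2) two_ne_zero
  simpa using this.symm

/-- For fixed `k` the modular grows at most quadratically, so `L²` approximation by test functions
suffices. The factor `k^(p-2)` multiplies only the approximation error, which vanishes before `k`
varies. -/
lemma ofReal_truncPow_norm_le {p k : ℝ} (hp : 2 ≤ p) (hk : 0 ≤ k) {F : Type*}
    [NormedAddCommGroup F] (a b : F) :
    ENNReal.ofReal (truncPow p k ‖a‖) ≤ ENNReal.ofReal (2 ^ p) *
      (ENNReal.ofReal (truncPow p k ‖b‖) + ENNReal.ofReal (k ^ (p - 2)) * ‖b - a‖ₑ ^ 2) := by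
  have h1 : truncPow p k ‖a‖ ≤ truncPow p k (‖b‖ + ‖b - a‖) := by
    apply truncPow_mono hp hk
    rw [abs_norm, abs_of_nonneg (by positivity)]
    have := norm_sub_norm_le a b
    rw [norm_sub_rev] at this
    linarith
  have h2 := truncPow_add_le hp hk ‖b‖ ‖b - a‖
  have h3 := truncPow_le_quad hp hk ‖b - a‖
  have h4 := truncPow_nonneg (p := p) hk ‖b‖
  rw [← ofReal_norm (b - a), ← ENNReal.ofReal_pow (norm_nonneg _),
    ← ENNReal.ofReal_mul (by positivity), ← ENNReal.ofReal_add h4 (by positivity),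
    ← ENNReal.ofReal_mul (by positivity)]
  refine ENNReal.ofReal_le_ofReal ((h1.trans h2).trans ?_)
  gcongr

lemma lintegral_eq_setLIntegral_of_testFunction {φ : E N → ℝ} (hφ : IsTestFunction Ω φ)
    {G : E N → ℝ≥0∞} (hG : ∀ x, gradient φ x = 0 → G x = 0) :
    ∫⁻ x, G x = ∫⁻ x in Ω, G x := by
  symm
  apply setLIntegral_eq_of_support_subset
  intro x hx
  by_contra h
  exact hx (hG x (tsupport_gradient_subset φ fun h' => h (hφ.2.2 h')))

/-- The modular Poincaré inequality in `H¹₀(Ω)`. -/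
lemma lintegral_truncPow_val_le {p k : ℝ} (hp : 2 ≤ p) (hk : 0 ≤ k) (u : H10 Ω)
    {h : E N} (hh : h ≠ 0) (hΩh : ∀ x ∈ Ω, x + h ∉ Ω) :
    ∫⁻ x in Ω, ENNReal.ofReal (truncPow p k (val u x / ‖h‖)) ≤
      ENNReal.ofReal (2 ^ p) * (ENNReal.ofReal (2 ^ (p + 1)) * (ENNReal.ofReal (2 ^ p) *
        ∫⁻ x in Ω, ENNReal.ofReal (truncPow p k ‖grad u x‖))) := by
  obtain ⟨φ, hφ, h1, h2⟩ := exists_testFunction_seq u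
  set I := ∫⁻ x in Ω, ENNReal.ofReal (truncPow p k ‖grad u x‖)
  set κ := ENNReal.ofReal (k ^ (p - 2))
  set e₁ := fun n => eLpNorm (fun x => φ n x - val u x) 2 (leb Ω)
  set e₂ := fun n => eLpNorm (fun x => gradient (φ n) x - grad u x) 2 (leb Ω)
  have hlim : Tendsto (fun n => ENNReal.ofReal (2 ^ p) * (ENNReal.ofReal (2 ^ (p + 1)) *
      (ENNReal.ofReal (2 ^ p) * (I + κ * e₂ n ^ 2)) + κ * (‖‖h‖⁻¹‖ₑ ^ 2 * e₁ n ^ 2))) atTop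
      (𝓝 (ENNReal.ofReal (2 ^ p) * (ENNReal.ofReal (2 ^ (p + 1)) *
      (ENNReal.ofReal (2 ^ p) * (I + κ * 0 ^ 2)) + κ * (‖‖h‖⁻¹‖ₑ ^ 2 * 0 ^ 2)))) := by
    have t1 : Tendsto (fun n => κ * (‖‖h‖⁻¹‖ₑ ^ 2 * e₁ n ^ 2)) atTop
        (𝓝 (κ * (‖‖h‖⁻¹‖ₑ ^ 2 * 0 ^ 2))) :=
      ENNReal.Tendsto.const_mul (ENNReal.Tendsto.const_mul (ENNReal.Tendsto.pow h1)
        (Or.inr (by simp))) (Or.inr (by simp [κ]))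
    have t2 : Tendsto (fun n => I + κ * e₂ n ^ 2) atTop (𝓝 (I + κ * 0 ^ 2)) :=
      tendsto_const_nhds.add (ENNReal.Tendsto.const_mul (ENNReal.Tendsto.pow h2)
        (Or.inr (by simp [κ])))
    exact ENNReal.Tendsto.const_mul ((ENNReal.Tendsto.const_mul
      (ENNReal.Tendsto.const_mul t2 (Or.inr (by simp))) (Or.inr (by simp))).add t1)
      (Or.inr (by simp))
  simp only [ne_eq, OfNat.ofNat_ne_zero, not_false_eq_true, zero_pow, mul_zero, add_zero] at hlim
  refine ge_of_tendsto' hlim fun n => ?_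
  have mφ : Continuous (φ n) := (hφ n).1.continuous
  have mg : Continuous (gradient (φ n)) := continuous_gradient (hφ n).1
  have mt : Measurable (truncPow p k) := measurable_truncPow
  have s1 : ∫⁻ x in Ω, ENNReal.ofReal (truncPow p k (val u x / ‖h‖)) ≤
      ENNReal.ofReal (2 ^ p) * ((∫⁻ x in Ω, ENNReal.ofReal (truncPow p k (φ n x / ‖h‖))) +
        κ * (‖‖h‖⁻¹‖ₑ ^ 2 * e₁ n ^ 2)) := by
    simp only [e₁]
    rw [← lintegral_enorm_sq_eq, ← lintegral_const_mul' _ _ (by simp),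
      ← lintegral_const_mul' κ _ (by simp [κ]),
      ← lintegral_add_left (f := fun x => ENNReal.ofReal (truncPow p k (φ n x / ‖h‖)))
        (mt.comp (mφ.measurable.div_const _)).ennreal_ofReal,
      ← lintegral_const_mul' _ _ (by simp)]
    refine lintegral_mono fun x => ?_
    have := ofReal_truncPow_norm_le hp hk (val u x / ‖h‖) (φ n x / ‖h‖)
    rw [Real.norm_eq_abs, Real.norm_eq_abs, truncPow_abs, truncPow_abs, ← sub_div,
      div_eq_inv_mul (φ n x - val u x), enorm_mul, mul_pow] at this
    exact this
  have s2 : ∫⁻ x in Ω, ENNReal.ofReal (truncPow p k (φ n x / ‖h‖)) ≤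
      ENNReal.ofReal (2 ^ (p + 1)) *
        ∫⁻ x in Ω, ENNReal.ofReal (truncPow p k ‖gradient (φ n) x‖) := by
    rw [← lintegral_eq_setLIntegral_of_testFunction (hφ n)
      (G := fun x => ENNReal.ofReal (truncPow p k ‖gradient (φ n) x‖))
      (by simp +contextual [truncPow])]
    exact (setLIntegral_le_lintegral _ _).trans
      (lintegral_truncPow_div_le hp hk (hφ n) hh hΩh)
  have s3 : ∫⁻ x in Ω, ENNReal.ofReal (truncPow p k ‖gradient (φ n) x‖) ≤
      ENNReal.ofReal (2 ^ p) * (I + κ * e₂ n ^ 2) := by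
    simp only [I, e₂]
    rw [← lintegral_enorm_sq_eq, ← lintegral_const_mul' κ _ (by simp [κ]),
      ← lintegral_add_left (f := fun x => ENNReal.ofReal (truncPow p k ‖grad u x‖))
        (mt.comp (stronglyMeasurable_grad u).measurable.norm).ennreal_ofReal,
      ← lintegral_const_mul' _ _ (by simp)]
    refine lintegral_mono fun x => ?_
    have := ofReal_truncPow_norm_le hp hk (gradient (φ n) x) (grad u x)
    rwa [← enorm_neg, neg_sub] at this
  exact s1.trans (by gcongr; exact s2.trans (by gcongr))

/-- The `L¹` modulus of continuity of functions in `H¹₀(Ω)`, extended by zero. -/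
lemma lintegral_translate_indicator_sub_le (hΩ : MeasurableSet Ω) (hfin : volume Ω ≠ ⊤)
    (u : H10 Ω) (h : E N) :
    ∫⁻ x, ‖Ω.indicator (val u) (x + h) - Ω.indicator (val u) x‖ₑ ≤
      ‖h‖ₑ * ∫⁻ x in Ω, ‖grad u x‖ₑ := by
  obtain ⟨φ, hφ, h1, h2⟩ := exists_testFunction_seq u
  have hle : ∀ {F : Type} [NormedAddCommGroup F] {f : ℕ → E N → F},
      (∀ n, AEStronglyMeasurable (f n) (leb Ω)) →
      Tendsto (fun n => eLpNorm (f n) 2 (leb Ω)) atTop (𝓝 0) →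
      Tendsto (fun n => ∫⁻ x in Ω, ‖f n x‖ₑ) atTop (𝓝 0) := by
    intro F _ f hf hlim
    have hlim' := ENNReal.Tendsto.mul_const (b := leb Ω Set.univ ^ (1 / (1 : ℝ≥0∞).toReal -
      1 / (2 : ℝ≥0∞).toReal)) hlim (Or.inr (by
        refine (ENNReal.rpow_lt_top_of_nonneg ?_ ?_).ne
        · norm_num
        · simpa using hfin))
    rw [zero_mul] at hlim'
    refine tendsto_of_tendsto_of_tendsto_of_le_of_le tendsto_const_nhds hlim'
      (fun _ => zero_le) fun n => ?_
    have := eLpNorm_le_eLpNorm_mul_rpow_measure_univ (p := 1) (q := 2) (by norm_num) (hf n)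
    rwa [eLpNorm_one_eq_lintegral_enorm] at this
  have mφ : ∀ n, Continuous (φ n) := fun n => (hφ n).1.continuous
  have mg : ∀ n, Continuous (gradient (φ n)) := fun n => continuous_gradient (hφ n).1
  have mu := stronglyMeasurable_val u
  have mgu := stronglyMeasurable_grad u
  have l1 := hle (fun n => ((mφ n).stronglyMeasurable.sub mu).aestronglyMeasurable) h1
  have l2 := hle (fun n => ((mg n).stronglyMeasurable.sub mgu).aestronglyMeasurable) h2
  have hlim : Tendsto (fun n => ‖h‖ₑ * ((∫⁻ x in Ω, ‖grad u x‖ₑ) +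
      ∫⁻ x in Ω, ‖gradient (φ n) x - grad u x‖ₑ) + 2 * ∫⁻ x in Ω, ‖φ n x - val u x‖ₑ) atTop
      (𝓝 (‖h‖ₑ * ((∫⁻ x in Ω, ‖grad u x‖ₑ) + 0) + 2 * 0)) :=
    (ENNReal.Tendsto.const_mul (tendsto_const_nhds.add l2) (Or.inr (by simp))).add
      (ENNReal.Tendsto.const_mul l1 (Or.inr (by simp)))
  rw [mul_zero, add_zero, add_zero] at hlim
  refine ge_of_tendsto' hlim fun n => ?_
  have hind : ∀ x, φ n x = Ω.indicator (φ n) x := fun x => by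
    by_cases hx : x ∈ Ω
    · simp [hx]
    · rw [Set.indicator_of_notMem hx]
      by_contra h0
      exact hx ((hφ n).2.2 (subset_tsupport _ h0))
  -- `D` is the approximation error extended by zero; it enters once at `x` and once at `x + h`,
  -- with the same integral.
  set D := fun x => ‖Ω.indicator (fun x => φ n x - val u x) x‖ₑ
  have hD : Measurable D := (((mφ n).measurable.sub mu.measurable).indicator hΩ).enorm
  have hDx : ∀ x, D x = ‖φ n x - Ω.indicator (val u) x‖ₑ := fun x => by
    simp only [D]
    rw [hind x]
    by_cases hx : x ∈ Ω <;> simp [hx]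
  have hDint : ∫⁻ x, D x = ∫⁻ x in Ω, ‖φ n x - val u x‖ₑ := by
    rw [← lintegral_indicator hΩ]
    refine lintegral_congr fun x => ?_
    simp only [D]
    by_cases hx : x ∈ Ω <;> simp [hx]
  have hpt : ∀ x, ‖Ω.indicator (val u) (x + h) - Ω.indicator (val u) x‖ₑ ≤
      ‖φ n (x + h) - φ n x‖ₑ + (D (x + h) + D x) := fun x => by
    rw [hDx, hDx]
    have e : Ω.indicator (val u) (x + h) - Ω.indicator (val u) x =
      (φ n (x + h) - φ n x) - (φ n (x + h) - Ω.indicator (val u) (x + h)) +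
        (φ n x - Ω.indicator (val u) x) := by ring
    rw [e, ← add_assoc]
    exact (enorm_add_le _ _).trans (by gcongr; exact enorm_sub_le)
  calc ∫⁻ x, ‖Ω.indicator (val u) (x + h) - Ω.indicator (val u) x‖ₑ
      ≤ ∫⁻ x, (‖φ n (x + h) - φ n x‖ₑ + (D (x + h) + D x)) := lintegral_mono hpt
    _ = (∫⁻ x, ‖φ n (x + h) - φ n x‖ₑ) + ((∫⁻ x, D (x + h)) + ∫⁻ x, D x) := by
        rw [lintegral_add_left, lintegral_add_right _ hD]
        exact (((mφ n).comp (continuous_add_const h)).sub (mφ n)).enorm.measurable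
    _ = (∫⁻ x, ‖φ n (x + h) - φ n x‖ₑ) + 2 * ∫⁻ x in Ω, ‖φ n x - val u x‖ₑ := by
        rw [lintegral_add_right_eq_self D h, hDint, two_mul]
    _ ≤ _ := by
        gcongr
        refine (lintegral_translate_sub_le (hφ n).1 h).trans ?_
        gcongr
        rw [lintegral_eq_setLIntegral_of_testFunction (hφ n) (by simp +contextual),
          ← lintegral_add_left mgu.enorm]
        refine lintegral_mono fun x => ?_
        calc ‖gradient (φ n) x‖ₑ = ‖grad u x + (gradient (φ n) x - grad u x)‖ₑ := by
              rw [add_sub_cancel]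
          _ ≤ _ := enorm_add_le _ _

end Sobolev


/-! ### Compactness of `H¹₀(Ω)` in `L¹(Ω)` -/

section Compactness

variable {N : ℕ} {Ω : Set (E N)}

lemma WeakTendstoH10.tendsto_integral {y : ℕ → H10 Ω} {y₀ : H10 Ω} (h : WeakTendstoH10 y y₀)
    {v : E N → ℝ} (hv : MemLp v 2 (leb Ω)) :
    Tendsto (fun n => ∫ x in Ω, val (y n) x * v x) atTop (𝓝 (∫ x in Ω, val y₀ x * v x)) := by
  let ℓ : H10 Ω →L[ℝ] ℝ := (innerSL ℝ (hv.toLp v)).comp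
    ((ContinuousLinearMap.fst ℝ _ _).comp (H10 Ω).subtypeL)
  have hℓ : ∀ u : H10 Ω, ℓ u = ∫ x in Ω, val u x * v x := fun u => by
    have : ℓ u = inner ℝ (hv.toLp v) u.1.1 := rfl
    rw [this, L2.inner_def]
    refine integral_congr_ae ?_
    filter_upwards [hv.coeFn_toLp] with x hx
    rw [hx]
    rfl
  have h1 := ((WeakBilin.eval_continuous (topDualPairing ℝ (H10 Ω)).flip ℓ).tendsto
    (toWeakSpace ℝ (H10 Ω) y₀)).comp h
  have h2 : Tendsto (fun n => ℓ (y n)) atTop (𝓝 (ℓ y₀)) := h1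
  simpa only [hℓ] using h2

/-- A sequence in `H¹₀(Ω)` that is bounded in `W^{1,1}` and converges weakly to zero in `L²(Ω)`
converges to zero in `L¹(Ω)`. -/
lemma tendsto_lintegral_val_zero (hΩ : MeasurableSet Ω) (hfin : volume Ω ≠ ⊤) {w : ℕ → H10 Ω}
    {M : ℝ≥0∞} (hM : M ≠ ⊤) (hgrad : ∀ n, ∫⁻ x in Ω, ‖grad (w n) x‖ₑ ≤ M)
    (hval : ∀ n, ∫⁻ x in Ω, ‖val (w n) x‖ₑ ≤ M)
    (hweak : ∀ v : E N → ℝ, MemLp v 2 (leb Ω) →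
      Tendsto (fun n => ∫ x in Ω, val (w n) x * v x) atTop (𝓝 0)) :
    Tendsto (fun n => ∫⁻ x in Ω, ‖val (w n) x‖ₑ) atTop (𝓝 0) := by
  have hfinm : IsFiniteMeasure (leb Ω) := ⟨by simpa using hfin.lt_top⟩
  rw [ENNReal.tendsto_nhds_zero]
  intro ε hε
  obtain ⟨δ, hδ, hδM⟩ := ENNReal.exists_nnreal_pos_mul_lt hM
    (ENNReal.div_pos hε.ne' ENNReal.ofNat_ne_top : 0 < ε / 2).ne'
  set B : Set (E N) := Metric.ball 0 δ
  set V := volume B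
  have hV0 : V ≠ 0 := (Metric.measure_ball_pos _ _ (by exact_mod_cast hδ)).ne'
  have hVtop : V ≠ ⊤ := measure_ball_lt_top.ne
  have hBm : MeasurableSet B := measurableSet_ball
  set W : ℕ → E N → ℝ := fun n => Ω.indicator (val (w n))
  have hWm : ∀ n, StronglyMeasurable (W n) := fun n => (stronglyMeasurable_val _).indicator hΩ
  have hWM : ∀ n, ∫⁻ x, ‖W n x‖ₑ ≤ M := fun n => by
    refine le_trans (le_of_eq ?_) (hval n)
    rw [← lintegral_indicator hΩ]
    refine lintegral_congr fun x => ?_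
    by_cases hx : x ∈ Ω <;> simp [W, hx]
  have hWi : ∀ n, Integrable (W n) := fun n =>
    ⟨(hWm n).aestronglyMeasurable, (hWM n).trans_lt hM.lt_top⟩
  -- Ball averages, left unnormalized. At each point they are pairings of `w n` with the indicator
  -- of a ball, so weak convergence gives pointwise convergence, and dominated convergence gives
  -- `L¹` convergence on `Ω`. The distance from a function to its average is controlled by
  -- translates, uniformly in `n`.
  set m : ℕ → E N → ℝ := fun n x => ∫ h in B, W n (x + h)
  have hmm : ∀ n, StronglyMeasurable (m n) := fun n =>
    StronglyMeasurable.integral_prod_right' (f := fun z : E N × E N => W n (z.1 + z.2))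
      ((hWm n).comp_measurable (by fun_prop))
  have hmle : ∀ n x, ‖m n x‖ₑ ≤ M := fun n x => by
    refine (enorm_integral_le_lintegral_enorm _).trans ((setLIntegral_le_lintegral _ _).trans ?_)
    rw [lintegral_add_left_eq_self (fun y => ‖W n y‖ₑ) x]
    exact hWM n
  have hmlim : ∀ x, Tendsto (fun n => m n x) atTop (𝓝 0) := fun x => by
    have h1 : MemLp ((Metric.ball x δ).indicator fun _ => (1 : ℝ)) 2 (leb Ω) :=
      (memLp_const 1).indicator measurableSet_ball
    refine (hweak _ h1).congr fun n => ?_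
    simp only [m]
    rw [← integral_indicator hBm, ← integral_indicator hΩ,
      ← integral_add_left_eq_self _ x]
    refine integral_congr_ae (Eventually.of_forall fun h => ?_)
    by_cases hx : x + h ∈ Ω <;> by_cases hb : h ∈ B <;>
      simp_all [W, B]
  have hmint : Tendsto (fun n => ∫⁻ x in Ω, ‖m n x‖ₑ) atTop (𝓝 0) := by
    have := tendsto_lintegral_of_dominated_convergence (μ := leb Ω)
      (F := fun n x => ‖m n x‖ₑ) (f := fun _ => 0) (fun _ => M) (fun n => (hmm n).enorm)
      (fun n => Eventually.of_forall fun x => hmle n x)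
      (by simpa using ENNReal.mul_ne_top hM hfin)
      (Eventually.of_forall fun x => by simpa using (hmlim x).enorm)
    simpa using this
  have hkey : ∀ n, V * ∫⁻ x in Ω, ‖val (w n) x‖ₑ ≤ V * (δ * M) + ∫⁻ x in Ω, ‖m n x‖ₑ := by
    intro n
    have hpt : ∀ x, V * ‖W n x‖ₑ ≤ (∫⁻ h in B, ‖W n (x + h) - W n x‖ₑ) + ‖m n x‖ₑ := by
      intro x
      have hi : IntegrableOn (fun h => W n (x + h)) B := ((hWi n).comp_add_left x).integrableOn
      have hc : IntegrableOn (fun _ : E N => W n x) B := integrableOn_const hVtop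
      have e : V.toReal * W n x = m n x - ∫ h in B, (W n (x + h) - W n x) := by
        rw [integral_sub hi hc]
        simp [m, V, Measure.real]
      have e1 : V * ‖W n x‖ₑ = ‖V.toReal * W n x‖ₑ := by
        rw [enorm_mul, Real.enorm_of_nonneg ENNReal.toReal_nonneg, ENNReal.ofReal_toReal hVtop]
      rw [e1, e, add_comm]
      exact enorm_sub_le.trans (by gcongr; exact enorm_integral_le_lintegral_enorm _)
    have hjm : Measurable (Function.uncurry fun x h : E N => ‖W n (x + h) - W n x‖ₑ) := by
      have := (hWm n).measurable
      simp only [Function.uncurry_def]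
      fun_prop
    calc V * ∫⁻ x in Ω, ‖val (w n) x‖ₑ = ∫⁻ x in Ω, V * ‖W n x‖ₑ := by
          rw [lintegral_const_mul' _ _ hVtop]
          congr 1
          exact setLIntegral_congr_fun hΩ fun x hx => by simp [W, hx]
      _ ≤ ∫⁻ x in Ω, ((∫⁻ h in B, ‖W n (x + h) - W n x‖ₑ) + ‖m n x‖ₑ) :=
          lintegral_mono hpt
      _ = (∫⁻ x in Ω, ∫⁻ h in B, ‖W n (x + h) - W n x‖ₑ) + ∫⁻ x in Ω, ‖m n x‖ₑ :=
          lintegral_add_right _ (hmm n).enorm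
      _ ≤ V * (δ * M) + ∫⁻ x in Ω, ‖m n x‖ₑ := by
          gcongr
          calc ∫⁻ x in Ω, ∫⁻ h in B, ‖W n (x + h) - W n x‖ₑ
              ≤ ∫⁻ x, ∫⁻ h in B, ‖W n (x + h) - W n x‖ₑ := setLIntegral_le_lintegral _ _
            _ = ∫⁻ h in B, ∫⁻ x, ‖W n (x + h) - W n x‖ₑ :=
                lintegral_lintegral_swap hjm.aemeasurable
            _ ≤ ∫⁻ h in B, δ * M := by
                refine setLIntegral_mono' hBm fun h hh => ?_
                refine (lintegral_translate_indicator_sub_le hΩ hfin (w n) h).trans ?_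
                gcongr
                · have : ‖h‖ ≤ δ := by simpa [B] using (mem_ball_zero_iff.1 hh).le
                  rw [← ofReal_norm, ← ENNReal.ofReal_coe_nnreal]
                  exact ENNReal.ofReal_le_ofReal this
                · exact hgrad n
            _ = V * (δ * M) := by
                rw [setLIntegral_const, mul_comm]
  have hε2 : V * (ε / 2) ≠ 0 := mul_ne_zero hV0 (ENNReal.div_pos hε.ne' ENNReal.ofNat_ne_top).ne'
  filter_upwards [(ENNReal.tendsto_nhds_zero.1 hmint) _ (pos_iff_ne_zero.2 hε2)] with n hn
  rw [← ENNReal.mul_le_mul_iff_right hV0 hVtop]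
  calc V * ∫⁻ x in Ω, ‖val (w n) x‖ₑ ≤ V * (δ * M) + V * (ε / 2) :=
        (hkey n).trans (by gcongr)
    _ ≤ V * (ε / 2) + V * (ε / 2) := by gcongr
    _ = V * ε := by rw [← mul_add, ENNReal.add_halves]

end Compactness


/-! ### Energy estimate for the regularized state equation -/

section Energy

variable {N : ℕ} {Ω : Set (E N)}

lemma posSemidef_of_inner_nonneg {M : Matrix (Fin N) (Fin N) ℝ} (hM : M.IsSymm)
    (h : ∀ v : E N, 0 ≤ inner ℝ v (act M v)) : M.PosSemidef := by
  refine Matrix.PosSemidef.of_dotProduct_mulVec_nonneg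
    (by rw [Matrix.IsHermitian, Matrix.conjTranspose_eq_transpose_of_trivial]; exact hM) fun x => ?_
  have := h (WithLp.toLp 2 x)
  rwa [act, Matrix.inner_toEuclideanCLM] at this

open scoped MatrixOrder in
lemma norm_act_msqrt_sq {M : Matrix (Fin N) (Fin N) ℝ} (hM : M.PosSemidef) (v : E N) :
    ‖act (msqrt M) v‖ ^ 2 = inner ℝ v (act M v) := by
  have hS : (msqrt M).IsSymm := by
    have h1 : (0 : Matrix (Fin N) (Fin N) ℝ) ≤ msqrt M := CFC.sqrt_nonneg M
    have h2 := (Matrix.nonneg_iff_posSemidef.1 h1).1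
    rwa [Matrix.IsHermitian, Matrix.conjTranspose_eq_transpose_of_trivial] at h2
  have hSS : msqrt M * msqrt M = M :=
    CFC.sqrt_mul_sqrt_self M (Matrix.nonneg_iff_posSemidef.2 hM)
  conv_rhs => rw [← hSS]
  rw [← real_inner_self_eq_norm_sq, act, act, Matrix.inner_toEuclideanCLM,
    Matrix.inner_toEuclideanCLM, Matrix.ofLp_toEuclideanCLM, ← Matrix.mulVec_mulVec,
    Matrix.dotProduct_mulVec v.ofLp, ← Matrix.mulVec_transpose, hS]

lemma aestronglyMeasurable_inner_act {A : E N → Matrix (Fin N) (Fin N) ℝ}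
    (hA : MemLinftySym Ω A) (u : H10 Ω) :
    AEStronglyMeasurable (fun x => inner ℝ (grad u x) (act (A x) (grad u x))) (leb Ω) := by
  have e : (fun x => inner ℝ (grad u x) (act (A x) (grad u x))) =
      fun x => ∑ i, grad u x i * ∑ j, A x i j * grad u x j := by
    ext x
    rw [act, Matrix.inner_toEuclideanCLM]
    rfl
  have hg : ∀ i, AEStronglyMeasurable (fun x => grad u x i) (leb Ω) := fun i =>
    ((EuclideanSpace.proj (𝕜 := ℝ) i).continuous.comp_stronglyMeasurable
      (stronglyMeasurable_grad u)).aestronglyMeasurable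
  rw [e]
  refine Finset.aestronglyMeasurable_fun_sum _ fun i _ => (hg i).mul ?_
  exact Finset.aestronglyMeasurable_fun_sum _ fun j _ => (hA.1 i j).1.mul (hg j)

/-- The equation is tested with its own solution; `|A^{1/2}∇y|² = (∇y, A∇y)` dominates `α²|∇y|²`,
and the weight dominates the truncated power. -/
lemma lintegral_truncPow_grad_le_energy {ξ₁ ξ₂ : E N → ℝ} {γ α p ε : ℝ} (hp : 2 ≤ p) (hα : 0 < α)
    (hξ₂ : MemLp ξ₂ ⊤ (leb Ω)) (hξ : ∀ᵐ x ∂(leb Ω), α ≤ ξ₁ x ∧ ξ₁ x ≤ ξ₂ x)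
    {k : ℕ} {T : ℝ → ℝ} (hT : IsTruncation k T) (hε : 0 < ε) {f : E N → ℝ}
    {A : E N → Matrix (Fin N) (Fin N) ℝ} (hA : IsAdmissibleControl Ω ξ₁ ξ₂ γ A)
    {y : H10 Ω} (hy : IsWeakSolution Ω p ε T f A y) :
    ∫⁻ x in Ω, ENNReal.ofReal (truncPow p k (α * ‖grad y x‖)) ≤
      ENNReal.ofReal (∫ x in Ω, f x * val y x) := by
  set s : E N → ℝ := fun x => inner ℝ (grad y x) (act (A x) (grad y x))
  set I : E N → ℝ := fun x => regWeight p ε T (√(s x)) * s x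
  have hs : ∀ᵐ x ∂(leb Ω), ‖act (msqrt (A x)) (grad y x)‖ ^ 2 = s x ∧
      α * ‖grad y x‖ ≤ √(s x) ∧ s x ≤ ξ₂ x ^ 2 * ‖grad y x‖ ^ 2 := by
    filter_upwards [hA.bounds, hA.memLinfty.2, hξ] with x hx hx' hx''
    have hpsd : (A x).PosSemidef := posSemidef_of_inner_nonneg hx' fun v =>
      le_trans (by positivity) (hx v).1
    refine ⟨norm_act_msqrt_sq hpsd _, ?_, (hx _).2⟩
    apply Real.le_sqrt_of_sq_le
    refine le_trans ?_ (hx (grad y x)).1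
    rw [mul_pow]
    have := hx''.1
    gcongr
  have hIeq : ∫ x in Ω, I x = ∫ x in Ω, f x * val y x := by
    rw [← hy y]
    refine integral_congr_ae ?_
    filter_upwards [hs] with x hx
    have h0 : 0 ≤ s x := hx.1 ▸ sq_nonneg _
    rw [hx.1, real_inner_comm]
    simp only [I, regWeight, Real.sq_sqrt h0]
    rfl
  have hsm : AEStronglyMeasurable s (leb Ω) := aestronglyMeasurable_inner_act hA.memLinfty y
  have hIm : AEStronglyMeasurable I (leb Ω) :=
    (((continuous_regWeight hT hp).comp Real.continuous_sqrt).comp_aestronglyMeasurable hsm).mul hsm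
  have hI0 : 0 ≤ᵐ[leb Ω] I := by
    filter_upwards [hs] with x hx
    exact mul_nonneg (regWeight_nonneg hT hε _) (hx.1 ▸ sq_nonneg _)
  -- Integrability excludes the default value `0` of the integral. For fixed `k` the weight is
  -- bounded, so `ξ₂ ∈ L^∞` and `∇y ∈ L²` suffice.
  have hint : Integrable I (leb Ω) := by
    have hg : Integrable (fun x => ‖grad y x‖ ^ 2) (leb Ω) :=
      (memLp_two_iff_integrable_sq_norm (memLp_grad y).1).1 (memLp_grad y)
    refine (hg.const_mul ((ε + ((k : ℝ) ^ 2 + 1)) ^ ((p - 2) / 2) *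
      (eLpNorm ξ₂ ⊤ (leb Ω)).toReal ^ 2)).mono' hIm ?_
    filter_upwards [hs, hI0, ae_le_eLpNormEssSup (f := ξ₂) (μ := leb Ω)] with x hx hx0 hξx
    have h0 : 0 ≤ s x := hx.1 ▸ sq_nonneg _
    have hb : |ξ₂ x| ≤ (eLpNorm ξ₂ ⊤ (leb Ω)).toReal := by
      rw [← Real.norm_eq_abs, ← toReal_enorm]
      exact ENNReal.toReal_mono hξ₂.2.ne (by simpa using hξx)
    rw [Real.norm_of_nonneg hx0, mul_assoc]
    have h1 := regWeight_le_const hT hε hp (√(s x))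
    refine mul_le_mul h1 (hx.2.2.trans ?_) h0 (by positivity)
    rw [← sq_abs (ξ₂ x)]
    gcongr
  rw [← hIeq, ofReal_integral_eq_lintegral_ofReal hint hI0]
  refine lintegral_mono_ae ?_
  filter_upwards [hs] with x hx
  have h0 : 0 ≤ s x := hx.1 ▸ sq_nonneg _
  refine ENNReal.ofReal_le_ofReal ?_
  have h1 : truncPow p k (α * ‖grad y x‖) ≤ truncPow p k √(s x) := by
    refine truncPow_mono hp (by positivity) ?_
    rw [abs_of_nonneg (by positivity), abs_of_nonneg (by positivity)]
    exact hx.2.1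
  have h2 := truncPow_le_regWeight (p := p) hT hε hp √(s x)
  rw [Real.sq_sqrt h0] at h2
  exact h1.trans h2

lemma ofReal_truncPow_le_mul {p k : ℝ} (hp : 2 ≤ p) (hk : 0 ≤ k) {c : ℝ} (hc : 0 < c) (t : ℝ) :
    ENNReal.ofReal (truncPow p k t) ≤
      ENNReal.ofReal (max 1 c⁻¹ ^ p) * ENNReal.ofReal (truncPow p k (c * t)) := by
  rw [← ENNReal.ofReal_mul (by positivity)]
  refine ENNReal.ofReal_le_ofReal (le_trans ?_ (truncPow_mul_le hp hk (le_max_left _ _) _))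
  refine truncPow_mono hp hk ?_
  rw [abs_mul, abs_mul, abs_of_pos hc,
    abs_of_pos (lt_max_of_lt_left one_pos : 0 < max 1 c⁻¹)]
  calc |t| = c⁻¹ * (c * |t|) := by field_simp
    _ ≤ _ := by gcongr; exact le_max_right _ _

/-- Uniform modular bounds for the states, in terms of the work of the right-hand side. -/
lemma exists_modular_bound {ξ₁ ξ₂ : E N → ℝ} {γ α p : ℝ} (hN : 1 ≤ N) (hp : 2 ≤ p) (hα : 0 < α)
    (hΩb : Bornology.IsBounded Ω)
    (hξ₂ : MemLp ξ₂ ⊤ (leb Ω)) (hξ : ∀ᵐ x ∂(leb Ω), α ≤ ξ₁ x ∧ ξ₁ x ≤ ξ₂ x) (f : E N → ℝ) :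
    ∃ C : ℝ≥0∞, C ≠ ⊤ ∧ ∀ (k : ℕ) (T : ℝ → ℝ) (ε : ℝ) (A : E N → Matrix (Fin N) (Fin N) ℝ)
      (y : H10 Ω), IsTruncation k T → 0 < ε → IsAdmissibleControl Ω ξ₁ ξ₂ γ A →
      IsWeakSolution Ω p ε T f A y →
      ∫⁻ x in Ω, ENNReal.ofReal (truncPow p k ‖grad y x‖) ≤
          C * ENNReal.ofReal (∫ x in Ω, f x * val y x) ∧
        ∫⁻ x in Ω, ENNReal.ofReal (truncPow p k (val y x)) ≤
          C * ENNReal.ofReal (∫ x in Ω, f x * val y x) := by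
  obtain ⟨R, hR⟩ := hΩb.subset_ball 0
  -- A shift by twice a radius of `Ω` carries `Ω` off itself; `max R 1` keeps it nonzero, and `hN`
  -- supplies a coordinate direction.
  set d : ℝ := 2 * max R 1
  have hd : 0 < d := by positivity
  set h : E N := EuclideanSpace.single ⟨0, hN⟩ d
  have hh : ‖h‖ = d := by simp [h, abs_of_pos hd]
  have hh0 : h ≠ 0 := norm_pos_iff.1 (hh ▸ hd)
  have hΩh : ∀ x ∈ Ω, x + h ∉ Ω := fun x hx hxh => by
    have h1 := mem_ball_zero_iff.1 (hR hx)
    have h2 := mem_ball_zero_iff.1 (hR hxh)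
    have h3 : ‖h‖ ≤ ‖x + h‖ + ‖x‖ := by simpa using norm_sub_le (x + h) x
    have := le_max_left R 1
    rw [hh] at h3
    simp only [d] at h3
    linarith
  set C₁ := ENNReal.ofReal (max 1 α⁻¹ ^ p)
  set C₂ := ENNReal.ofReal (max 1 (d⁻¹)⁻¹ ^ p) *
    (ENNReal.ofReal (2 ^ p) * (ENNReal.ofReal (2 ^ (p + 1)) * ENNReal.ofReal (2 ^ p)))
  have hC₁ : C₁ ≠ ⊤ := ENNReal.ofReal_ne_top
  have hC₂ : C₂ ≠ ⊤ := by finiteness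
  refine ⟨C₁ + C₂ * C₁, by finiteness, fun k T ε A y hT hε hA hy => ?_⟩
  have hk : (0 : ℝ) ≤ k := by positivity
  have he := lintegral_truncPow_grad_le_energy hp hα hξ₂ hξ hT hε hA hy
  set W := ENNReal.ofReal (∫ x in Ω, f x * val y x)
  have h1 : ∫⁻ x in Ω, ENNReal.ofReal (truncPow p k ‖grad y x‖) ≤ C₁ * W := by
    refine le_trans ?_ (mul_le_mul_right he C₁)
    rw [← lintegral_const_mul' _ _ hC₁]
    exact lintegral_mono fun x => ofReal_truncPow_le_mul hp hk hα _
  have h2 : ∫⁻ x in Ω, ENNReal.ofReal (truncPow p k (val y x)) ≤ C₂ * (C₁ * W) := by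
    have hP := lintegral_truncPow_val_le hp hk y hh0 hΩh
    rw [hh] at hP
    calc ∫⁻ x in Ω, ENNReal.ofReal (truncPow p k (val y x))
        ≤ ENNReal.ofReal (max 1 (d⁻¹)⁻¹ ^ p) *
            ∫⁻ x in Ω, ENNReal.ofReal (truncPow p k (val y x / d)) := by
          rw [← lintegral_const_mul' _ _ (by simp)]
          refine lintegral_mono fun x => ?_
          have := ofReal_truncPow_le_mul hp hk (inv_pos.2 hd) (val y x)
          rwa [← div_eq_inv_mul] at this
      _ ≤ ENNReal.ofReal (max 1 (d⁻¹)⁻¹ ^ p) * (ENNReal.ofReal (2 ^ p) *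
            (ENNReal.ofReal (2 ^ (p + 1)) * (ENNReal.ofReal (2 ^ p) * (C₁ * W)))) := by
          gcongr
          exact hP.trans (by gcongr)
      _ = C₂ * (C₁ * W) := by simp only [C₂]; ring
  refine ⟨h1.trans ?_, h2.trans ?_⟩
  · gcongr; exact le_self_add
  · rw [← mul_assoc]; gcongr; exact le_add_self

end Energy


/-! ### Weak compactness and kernel operators in `L^p` -/

section Lebesgue

variable {X : Type*} [MeasurableSpace X] {μ : Measure X} {P Q : ℝ≥0∞}

lemma eLpNorm_one_mul_le [P.HolderConjugate Q] {u v : X → ℝ}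
    (hu : AEStronglyMeasurable u μ) (hv : AEStronglyMeasurable v μ) :
    eLpNorm (fun x => u x * v x) 1 μ ≤ eLpNorm u P μ * eLpNorm v Q μ := by
  have := eLpNorm_smul_le_mul_eLpNorm (p := P) (q := Q) (r := 1) hv hu
  exact this

lemma unifIntegrable_of_dominated {ι : Type*} {f : ι → X → ℝ} {g : X → ℝ} (hP : 1 ≤ P)
    (hP' : P ≠ ⊤) (hg : MemLp g P μ) (hfg : ∀ i, ∀ᵐ x ∂μ, ‖f i x‖ ≤ ‖g x‖) :
    UnifIntegrable f P μ := by
  intro ε hε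
  obtain ⟨δ, hδ, H⟩ := hg.eLpNorm_indicator_le hP hP' hε
  refine ⟨δ, hδ, fun i s hs hμs => le_trans (eLpNorm_mono_ae ?_) (H s hs hμs)⟩
  filter_upwards [hfg i] with x hx
  by_cases hxs : x ∈ s <;> simp_all

/-- Sequential weak compactness of bounded sequences in `L^Q`, without identification of
the limit. -/
lemma exists_subseq_integral_mul_tendsto [IsFiniteMeasure μ]
    [MeasurableSpace.CountablyGenerated X] [P.HolderConjugate Q] (hP' : P ≠ ⊤)
    {F : ℕ → X → ℝ} (hF : ∀ n, MemLp (F n) Q μ) {C : ℝ≥0∞} (hC : C ≠ ⊤)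
    (hFC : ∀ n, eLpNorm (F n) Q μ ≤ C) :
    ∃ φ : ℕ → ℕ, StrictMono φ ∧ ∀ v : X → ℝ, MemLp v P μ →
      ∃ l, Tendsto (fun n => ∫ x, F (φ n) x * v x ∂μ) atTop (𝓝 l) := by
  have : Q.HolderConjugate P := ENNReal.HolderConjugate.symm
  have f1 : Fact (1 ≤ P) := ⟨ENNReal.HolderConjugate.one_le P Q⟩
  have f2 : Fact (1 ≤ Q) := ⟨ENNReal.HolderConjugate.one_le Q P⟩
  have f3 : Fact (P ≠ ⊤) := ⟨hP'⟩
  let L := (ContinuousLinearMap.mul ℝ ℝ).lpPairing μ Q P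
  let ℓ : ℕ → WeakDual ℝ (Lp ℝ P μ) := fun n => StrongDual.toWeakDual (L ((hF n).toLp (F n)))
  have hball : ∀ n, ℓ n ∈ WeakDual.toStrongDual ⁻¹'
      Metric.closedBall (0 : StrongDual ℝ (Lp ℝ P μ)) (‖L‖ * C.toReal) := by
    intro n
    change L ((hF n).toLp (F n)) ∈ Metric.closedBall _ _
    rw [mem_closedBall_zero_iff]
    refine (L.le_opNorm _).trans (mul_le_mul_of_nonneg_left ?_ (norm_nonneg _))
    rw [Lp.norm_toLp]
    exact ENNReal.toReal_mono hC (hFC n)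
  -- Sequential Banach–Alaoglu in the dual of the separable space `L^P`. The limit functional need
  -- not be represented by a function.
  obtain ⟨ℓ₀, -, φ, hφ, hlim⟩ := WeakDual.isSeqCompact_closedBall ℝ (Lp ℝ P μ) 0
    (‖L‖ * C.toReal) hball
  refine ⟨φ, hφ, fun v hv => ⟨ℓ₀ (hv.toLp v), ?_⟩⟩
  have h1 := ((WeakDual.eval_continuous (hv.toLp v)).tendsto ℓ₀).comp hlim
  refine h1.congr fun n => ?_
  change L ((hF (φ n)).toLp _) (hv.toLp v) = _
  simp only [L]
  rw [ContinuousLinearMap.lpPairing_eq_integral]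
  refine integral_congr_ae ?_
  filter_upwards [(hF (φ n)).coeFn_toLp, hv.coeFn_toLp] with x h1 h2
  simp [h1, h2]

/-- Bounded sequences in `L^Q` that converge almost everywhere converge weakly. -/
lemma tendsto_integral_mul_of_ae [IsFiniteMeasure μ] [P.HolderConjugate Q] (hP' : P ≠ ⊤)
    {F : ℕ → X → ℝ} {F₀ : X → ℝ} (hF : ∀ n, MemLp (F n) Q μ) {C : ℝ≥0∞} (hC : C ≠ ⊤)
    (hFC : ∀ n, eLpNorm (F n) Q μ ≤ C)
    (hlim : ∀ᵐ x ∂μ, Tendsto (fun n => F n x) atTop (𝓝 (F₀ x))) :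
    MemLp F₀ Q μ ∧ ∀ v : X → ℝ, MemLp v P μ →
      Tendsto (fun n => ∫ x, F n x * v x ∂μ) atTop (𝓝 (∫ x, F₀ x * v x ∂μ)) := by
  have : Q.HolderConjugate P := ENNReal.HolderConjugate.symm
  have hP : 1 ≤ P := ENNReal.HolderConjugate.one_le P Q
  have hF₀ : MemLp F₀ Q μ := by
    refine ⟨aestronglyMeasurable_of_tendsto_ae atTop (fun n => (hF n).1) hlim, ?_⟩
    refine lt_of_le_of_lt (Lp.eLpNorm_lim_le_liminf_eLpNorm (fun n => (hF n).1) F₀ hlim) ?_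
    refine lt_of_le_of_lt ?_ hC.lt_top
    exact liminf_le_of_frequently_le' (Frequently.of_forall hFC)
  refine ⟨hF₀, fun v hv => ?_⟩
  refine tendsto_integral_of_L1' (fun x => F₀ x * v x) (hF₀.1.mul hv.1)
    (Eventually.of_forall fun n => (hF n).integrable_mul hv) ?_
  refine tendsto_Lp_finite_of_tendsto_ae le_rfl ENNReal.one_ne_top
    (fun n => (hF n).1.mul hv.1) (memLp_one_iff_integrable.2 (hF₀.integrable_mul hv)) ?_ ?_
  -- Vitali's theorem: by Hölder, the products are uniformly integrable because `v` alone has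
  -- absolutely continuous `L^P` norm; the `+ 1` keeps the denominator positive.
  · intro ε hε
    obtain ⟨δ, hδ, H⟩ := hv.eLpNorm_indicator_le hP hP'
      (ε := ε / (C.toReal + 1)) (by positivity)
    refine ⟨δ, hδ, fun n s hs hμs => ?_⟩
    have e : s.indicator (fun x => F n x * v x) = fun x => F n x * s.indicator v x := by
      ext x
      by_cases hx : x ∈ s <;> simp [hx]
    have h1 : eLpNorm (s.indicator (fun x => F n x * v x)) 1 μ ≤
        C * ENNReal.ofReal (ε / (C.toReal + 1)) := by
      rw [e]
      refine (eLpNorm_one_mul_le (P := Q) (Q := P) (hF n).1 (hv.1.indicator hs)).trans ?_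
      exact mul_le_mul' (hFC n) (H s hs hμs)
    refine h1.trans ?_
    rw [← ENNReal.ofReal_toReal hC, ← ENNReal.ofReal_mul ENNReal.toReal_nonneg]
    refine ENNReal.ofReal_le_ofReal ?_
    have : 0 ≤ C.toReal := ENNReal.toReal_nonneg
    rw [ENNReal.toReal_ofReal this, mul_div_assoc', div_le_iff₀ (by positivity)]
    nlinarith
  · filter_upwards [hlim] with x hx
    exact hx.mul_const _

variable {K : X → X → ℝ}

/-- The `L^P` norms of the sections of a kernel in `L^P` form a function in `L^P`. -/
lemma memLp_section_norm [SFinite μ] (hP0 : P ≠ 0) (hP' : P ≠ ⊤)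
    (hK : MemLp (Function.uncurry K) P (μ.prod μ)) :
    (∀ᵐ x ∂μ, MemLp (K x) P μ) ∧ MemLp (fun x => (eLpNorm (K x) P μ).toReal) P μ := by
  have hr : 0 < P.toReal := ENNReal.toReal_pos hP0 hP'
  have hm : AEMeasurable (fun z : X × X => ‖Function.uncurry K z‖ₑ ^ P.toReal) (μ.prod μ) :=
    hK.1.enorm.pow_const _
  have hfin : ∫⁻ x, ∫⁻ t, ‖K x t‖ₑ ^ P.toReal ∂μ ∂μ < ⊤ := by
    have := lintegral_rpow_enorm_lt_top_of_eLpNorm_lt_top hP0 hP' hK.2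
    rwa [lintegral_prod _ hm] at this
  have hm' : AEMeasurable (fun x => ∫⁻ t, ‖K x t‖ₑ ^ P.toReal ∂μ) μ := hm.lintegral_prod_right'
  have hae : ∀ᵐ x ∂μ, MemLp (K x) P μ := by
    filter_upwards [ae_lt_top' hm' hfin.ne, hK.1.prodMk_left] with x hx hx'
    exact ⟨hx', (eLpNorm_lt_top_iff_lintegral_rpow_enorm_lt_top hP0 hP').2 hx⟩
  have hκ : ∀ x, eLpNorm (K x) P μ = (∫⁻ t, ‖K x t‖ₑ ^ P.toReal ∂μ) ^ (1 / P.toReal) := fun x =>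
    eLpNorm_eq_lintegral_rpow_enorm_toReal hP0 hP'
  have hκm : AEMeasurable (fun x => eLpNorm (K x) P μ) μ := by
    simp_rw [hκ]
    exact hm'.pow_const _
  refine ⟨hae, hκm.ennreal_toReal.aestronglyMeasurable,
    (eLpNorm_lt_top_iff_lintegral_rpow_enorm_lt_top hP0 hP').2 (lt_of_le_of_lt ?_ hfin)⟩
  refine lintegral_mono_ae ?_
  filter_upwards [hae] with x hx
  rw [Real.enorm_of_nonneg ENNReal.toReal_nonneg, ENNReal.ofReal_toReal hx.2.ne, hκ,
    ← ENNReal.rpow_mul, one_div_mul_cancel hr.ne', ENNReal.rpow_one]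

lemma abs_integral_mul_le [P.HolderConjugate Q] {u v : X → ℝ} (hu : MemLp u P μ)
    (hv : MemLp v Q μ) :
    |∫ x, u x * v x ∂μ| ≤ (eLpNorm u P μ).toReal * (eLpNorm v Q μ).toReal := by
  rw [← Real.norm_eq_abs, ← toReal_enorm, ← ENNReal.toReal_mul]
  refine ENNReal.toReal_mono (ENNReal.mul_ne_top hu.2.ne hv.2.ne) ?_
  refine (enorm_integral_le_lintegral_enorm _).trans ?_
  rw [← eLpNorm_one_eq_lintegral_enorm]
  exact eLpNorm_one_mul_le hu.1 hv.1

lemma aestronglyMeasurable_kernel [SFinite μ] (hK : AEStronglyMeasurable (Function.uncurry K)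
    (μ.prod μ)) {u : X → ℝ} (hu : AEStronglyMeasurable u μ) :
    AEStronglyMeasurable (fun x => ∫ t, K x t * u t ∂μ) μ :=
  AEStronglyMeasurable.integral_prod_right' (f := fun z : X × X => K z.1 z.2 * u z.2)
    (hK.mul hu.comp_snd)

/-- A kernel in `L^P` maps `L^Q` into `L^P`. -/
lemma memLp_kernel [SFinite μ] [P.HolderConjugate Q] (hP' : P ≠ ⊤)
    (hK : MemLp (Function.uncurry K) P (μ.prod μ)) {u : X → ℝ} (hu : MemLp u Q μ) :
    MemLp (fun x => ∫ t, K x t * u t ∂μ) P μ := by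
  have hP0 : P ≠ 0 := (zero_lt_one.trans_le (ENNReal.HolderConjugate.one_le P Q)).ne'
  obtain ⟨h1, h2⟩ := memLp_section_norm hP0 hP' hK
  refine h2.of_le_mul (c := (eLpNorm u Q μ).toReal) (aestronglyMeasurable_kernel hK.1 hu.1) ?_
  filter_upwards [h1] with x hx
  rw [Real.norm_eq_abs, Real.norm_of_nonneg ENNReal.toReal_nonneg, mul_comm]
  exact abs_integral_mul_le hx hu

/-- A kernel in `L^P` maps weakly Cauchy sequences of `L^Q` to convergent sequences of `L^P`. -/
lemma exists_tendsto_kernel [IsFiniteMeasure μ] [P.HolderConjugate Q] (hP' : P ≠ ⊤)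
    (hK : MemLp (Function.uncurry K) P (μ.prod μ)) {F : ℕ → X → ℝ} (hF : ∀ n, MemLp (F n) Q μ)
    {C : ℝ≥0∞} (hC : C ≠ ⊤) (hFC : ∀ n, eLpNorm (F n) Q μ ≤ C)
    (hlim : ∀ v : X → ℝ, MemLp v P μ →
      ∃ l, Tendsto (fun n => ∫ x, F n x * v x ∂μ) atTop (𝓝 l)) :
    ∃ w : X → ℝ, MemLp w P μ ∧
      Tendsto (fun n => eLpNorm (fun x => (∫ t, K x t * F n t ∂μ) - w x) P μ) atTop (𝓝 0) := by
  have hP : 1 ≤ P := ENNReal.HolderConjugate.one_le P Q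
  have hP0 : P ≠ 0 := (zero_lt_one.trans_le hP).ne'
  obtain ⟨h1, h2⟩ := memLp_section_norm hP0 hP' hK
  have hm : ∀ n, AEStronglyMeasurable (fun x => ∫ t, K x t * F n t ∂μ) μ := fun n =>
    aestronglyMeasurable_kernel hK.1 (hF n).1
  -- Almost every section `K x` lies in `L^P`, so weak convergence may be tested against it. This
  -- gives pointwise convergence, dominated by the section norms.
  have hcv : ∀ᵐ x ∂μ, ∃ l, Tendsto (fun n => ∫ t, K x t * F n t ∂μ) atTop (𝓝 l) := by
    filter_upwards [h1] with x hx
    obtain ⟨l, hl⟩ := hlim _ hx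
    exact ⟨l, by simpa only [mul_comm] using hl⟩
  obtain ⟨w, hw, hwlim⟩ := exists_stronglyMeasurable_limit_of_tendsto_ae hm hcv
  have hdom : ∀ n, ∀ᵐ x ∂μ, ‖∫ t, K x t * F n t ∂μ‖ ≤
      ‖C.toReal * (eLpNorm (K x) P μ).toReal‖ := fun n => by
    filter_upwards [h1] with x hx
    rw [Real.norm_eq_abs, Real.norm_of_nonneg (by positivity), mul_comm]
    refine (abs_integral_mul_le hx (hF n)).trans ?_
    gcongr
    exact hFC n
  have hg := h2.const_mul C.toReal
  have hwP : MemLp w P μ := by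
    refine hg.mono hw.aestronglyMeasurable ?_
    filter_upwards [hwlim, ae_all_iff.2 hdom] with x hx hx'
    exact le_of_tendsto' hx.norm hx'
  exact ⟨w, hwP, tendsto_Lp_finite_of_tendsto_ae hP hP' hm hwP
    (unifIntegrable_of_dominated hP hP' hg hdom) hwlim⟩

end Lebesgue


/-! ### The regularized Hammerstein equation -/

section Equation

variable {X : Type*} [MeasurableSpace X] {μ : Measure X} {p q : ℝ}

lemma holderConjugate_ofReal (hp : 2 ≤ p) (hq : q = p / (p - 1)) :
    (ENNReal.ofReal p).HolderConjugate (ENNReal.ofReal q) :=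
  Real.HolderConjugate.ennrealOfReal (by rw [hq]; exact .conjExponent (by linarith))

lemma conjExponent_mem_Icc (hp : 2 ≤ p) (hq : q = p / (p - 1)) : 1 ≤ q ∧ q ≤ 2 := by
  have : 0 < p - 1 := by linarith
  rw [hq, le_div_iff₀ this, div_le_iff₀ this]
  constructor <;> linarith

section Fixed

variable {k : ℕ} {T : ℝ → ℝ} {ε : ℝ}

lemma nlFreg_eq (y z : ℝ) :
    nlFreg p ε T y z = regWeight p ε T y * y + regWeight p ε T z * z := rfl

lemma aestronglyMeasurable_regWeight (hT : IsTruncation k T) (hp : 2 ≤ p) {u : X → ℝ}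
    (hu : AEStronglyMeasurable u μ) :
    AEStronglyMeasurable (fun x => regWeight p ε T (u x)) μ :=
  (continuous_regWeight hT hp).comp_aestronglyMeasurable hu

lemma memLp_regWeight_mul (hT : IsTruncation k T) (hε : 0 < ε) (hp : 2 ≤ p) {u : X → ℝ}
    (hu : MemLp u 2 μ) : MemLp (fun x => regWeight p ε T (u x) * u x) 2 μ := by
  refine hu.of_le_mul (c := (ε + ((k : ℝ) ^ 2 + 1)) ^ ((p - 2) / 2))
    ((aestronglyMeasurable_regWeight hT hp hu.1).mul hu.1) (Eventually.of_forall fun x => ?_)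
  rw [norm_mul, Real.norm_of_nonneg (regWeight_nonneg hT hε _)]
  gcongr
  exact regWeight_le_const hT hε hp _

lemma memLp_nlFreg [IsFiniteMeasure μ] (hT : IsTruncation k T) (hε : 0 < ε) (hp : 2 ≤ p)
    (hq : q = p / (p - 1)) {y z : X → ℝ} (hy : MemLp y 2 μ) (hz : MemLp z 2 μ) :
    MemLp (fun x => nlFreg p ε T (y x) (z x)) 2 μ ∧
      MemLp (fun x => nlFreg p ε T (y x) (z x)) (ENNReal.ofReal q) μ := by
  have h := (memLp_regWeight_mul hT hε hp hy).add (memLp_regWeight_mul hT hε hp hz)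
  refine ⟨h, h.mono_exponent ?_⟩
  rw [← ENNReal.ofReal_ofNat]
  exact ENNReal.ofReal_le_ofReal (conjExponent_mem_Icc hp hq).2

/-- Positivity of the kernel operator controls the modular of `z` by that of `y`. -/
lemma lintegral_modular_le [IsFiniteMeasure μ] (hT : IsTruncation k T) (hε : 0 < ε) (hp : 2 ≤ p)
    (hq : q = p / (p - 1)) {K : X → X → ℝ}
    (hB : ∀ u : X → ℝ, MemLp u (ENNReal.ofReal q) μ →
      0 ≤ ∫ x, (∫ t, K x t * u t ∂μ) * u x ∂μ)
    {y z : X → ℝ} (hy : MemLp y 2 μ) (hz : MemLp z 2 μ)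
    (hH : ∀ᵐ x ∂μ, z x + ∫ t, K x t * nlFreg p ε T (y t) (z t) ∂μ = 0) :
    ∫⁻ x, ENNReal.ofReal (regWeight p ε T (z x) * z x ^ 2) ∂μ ≤
      4 * ∫⁻ x, ENNReal.ofReal (regWeight p ε T (y x) * y x ^ 2) ∂μ := by
  have hgy := memLp_regWeight_mul hT hε hp hy
  have hgz := memLp_regWeight_mul hT hε hp hz
  have i1 : Integrable (fun x => regWeight p ε T (y x) * y x * z x) μ := hgy.integrable_mul hz
  have i2 : Integrable (fun x => regWeight p ε T (z x) * z x ^ 2) μ := by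
    have : Integrable (fun x => regWeight p ε T (z x) * z x * z x) μ := hgz.integrable_mul hz
    simpa only [pow_two, ← mul_assoc] using this
  have i3 : Integrable (fun x => regWeight p ε T (y x) * y x ^ 2) μ := by
    have : Integrable (fun x => regWeight p ε T (y x) * y x * y x) μ := hgy.integrable_mul hy
    simpa only [pow_two, ← mul_assoc] using this
  have h0 := hB _ (memLp_nlFreg hT hε hp hq hy hz).2
  have h1 : ∫ x, (∫ t, K x t * nlFreg p ε T (y t) (z t) ∂μ) * nlFreg p ε T (y x) (z x) ∂μ =
      -((∫ x, regWeight p ε T (y x) * y x * z x ∂μ) +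
        ∫ x, regWeight p ε T (z x) * z x ^ 2 ∂μ) := by
    rw [← integral_add i1 i2, ← integral_neg]
    refine integral_congr_ae ?_
    filter_upwards [hH] with x hx
    rw [eq_neg_of_add_eq_zero_right hx, nlFreg_eq]
    ring
  -- Half of the modular of `z` is absorbed on the left; dividing the remainder by `1/2` gives the
  -- constant `4`.
  have h2 : -∫ x, regWeight p ε T (y x) * y x * z x ∂μ ≤
      (∫ x, regWeight p ε T (z x) * z x ^ 2 ∂μ) / 2 +
        2 * ∫ x, regWeight p ε T (y x) * y x ^ 2 ∂μ := by
    rw [← integral_neg, ← integral_div, ← integral_const_mul,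
      ← integral_add (i2.div_const 2) (i3.const_mul 2)]
    refine integral_mono i1.neg ((i2.div_const 2).add (i3.const_mul 2)) fun x => ?_
    exact (neg_le_abs _).trans (regWeight_mul_mul_le hT hε hp (y x) (z x))
  rw [← ofReal_integral_eq_lintegral_ofReal i2
      (Eventually.of_forall fun x => mul_nonneg (regWeight_nonneg hT hε _) (sq_nonneg _)),
    ← ofReal_integral_eq_lintegral_ofReal i3
      (Eventually.of_forall fun x => mul_nonneg (regWeight_nonneg hT hε _) (sq_nonneg _)),
    ← ENNReal.ofReal_ofNat 4, ← ENNReal.ofReal_mul (by norm_num)]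
  refine ENNReal.ofReal_le_ofReal ?_
  linarith

lemma enorm_rpow_eq_ofReal (t r : ℝ) (hr : 0 ≤ r) : ‖t‖ₑ ^ r = ENNReal.ofReal (|t| ^ r) := by
  rw [Real.enorm_eq_ofReal_abs, ENNReal.ofReal_rpow_of_nonneg (abs_nonneg t) hr]

lemma eLpNorm_regWeight_mul_le (hT : IsTruncation k T) (hε : 0 < ε) (hε1 : ε ≤ 1) (hp : 2 ≤ p)
    (hq : q = p / (p - 1)) {u : X → ℝ} :
    eLpNorm (fun x => regWeight p ε T (u x) * u x) (ENNReal.ofReal q) μ ≤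
      (ENNReal.ofReal ((3 ^ ((p - 2) / 2)) ^ q) *
        (μ Set.univ + ∫⁻ x, ENNReal.ofReal (regWeight p ε T (u x) * u x ^ 2) ∂μ)) ^ (1 / q) := by
  have hq1 := (conjExponent_mem_Icc hp hq).1
  have hq0 : 0 < q := by linarith
  rw [eLpNorm_eq_lintegral_rpow_enorm_toReal (by simpa using hq0) ENNReal.ofReal_ne_top,
    ENNReal.toReal_ofReal hq0.le]
  refine ENNReal.rpow_le_rpow ?_ (by positivity)
  have e : μ Set.univ = ∫⁻ _, 1 ∂μ := by simp
  rw [e, ← lintegral_add_left measurable_const, ← lintegral_const_mul' _ _ (by simp)]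
  refine lintegral_mono fun x => ?_
  have hw := mul_nonneg (regWeight_nonneg (p := p) hT hε (u x)) (sq_nonneg (u x))
  rw [enorm_rpow_eq_ofReal _ _ hq0.le, ← ENNReal.ofReal_one, ← ENNReal.ofReal_add zero_le_one hw,
    ← ENNReal.ofReal_mul (by positivity)]
  exact ENNReal.ofReal_le_ofReal (abs_regWeight_mul_rpow_le hT hε hε1 hp hq _)

end Fixed

/-- Compactness for the regularized Hammerstein equation: passage to the limit along
a subsequence. -/
lemma exists_subseq_hammerstein [IsFiniteMeasure μ] [MeasurableSpace.CountablyGenerated X]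
    (hp : 2 ≤ p) (hq : q = p / (p - 1)) {K : X → X → ℝ}
    (hK : MemLp (Function.uncurry K) (ENNReal.ofReal p) (μ.prod μ))
    (hB : ∀ u : X → ℝ, MemLp u (ENNReal.ofReal q) μ →
      0 ≤ ∫ x, (∫ t, K x t * u t ∂μ) * u x ∂μ)
    {k : ℕ → ℕ} (hk : Tendsto k atTop atTop) {T : ℕ → ℝ → ℝ}
    (hT : ∀ n, IsTruncation (k n) (T n)) {ε : ℕ → ℝ} (hεpos : ∀ n, 0 < ε n) (hε1 : ∀ n, ε n ≤ 1)
    (hε : Tendsto ε atTop (𝓝 0)) {y z : ℕ → X → ℝ} {y₀ z₀ : X → ℝ}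
    (hy : ∀ n, MemLp (y n) 2 μ) (hz : ∀ n, MemLp (z n) 2 μ) (hy₀ : AEStronglyMeasurable y₀ μ)
    (hz₀ : MemLp z₀ 2 μ)
    (hH : ∀ n, ∀ᵐ x ∂μ, z n x + ∫ t, K x t * nlFreg p (ε n) (T n) (y n t) (z n t) ∂μ = 0)
    {C : ℝ≥0∞} (hC : C ≠ ⊤)
    (hyC : ∀ n, ∫⁻ x, ENNReal.ofReal (regWeight p (ε n) (T n) (y n x) * y n x ^ 2) ∂μ ≤ C)
    (hylim : Tendsto (fun n => eLpNorm (y n - y₀) 1 μ) atTop (𝓝 0))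
    (hzlim : ∀ v : X → ℝ, MemLp v 2 μ →
      Tendsto (fun n => ∫ x, z n x * v x ∂μ) atTop (𝓝 (∫ x, z₀ x * v x ∂μ))) :
    MemLp y₀ (ENNReal.ofReal p) μ ∧ MemLp z₀ (ENNReal.ofReal p) μ ∧
    MemLp (fun x => nlF p (y₀ x) (z₀ x)) (ENNReal.ofReal q) μ ∧
    (∀ᵐ x ∂μ, z₀ x + ∫ t, K x t * nlF p (y₀ t) (z₀ t) ∂μ = 0) ∧
    ∃ φ : ℕ → ℕ, StrictMono φ ∧
      (∀ v : X → ℝ, MemLp v (ENNReal.ofReal p) μ →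
        Tendsto (fun n => ∫ x, nlFreg p (ε (φ n)) (T (φ n)) (y (φ n) x) (z (φ n) x) * v x ∂μ)
          atTop (𝓝 (∫ x, nlF p (y₀ x) (z₀ x) * v x ∂μ))) ∧
      Tendsto (fun n => eLpNorm (fun x => z (φ n) x - z₀ x) (ENNReal.ofReal p) μ)
        atTop (𝓝 0) := by
  have hconj := holderConjugate_ofReal hp hq
  have hP' : ENNReal.ofReal p ≠ ⊤ := ENNReal.ofReal_ne_top
  have hP2 : 2 ≤ ENNReal.ofReal p := by
    rw [← ENNReal.ofReal_ofNat]; exact ENNReal.ofReal_le_ofReal hp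
  have hP1 : 1 ≤ ENNReal.ofReal p := le_trans (by norm_num) hP2
  have hP0 : ENNReal.ofReal p ≠ 0 := (zero_lt_one.trans_le hP1).ne'
  have hq1 := (conjExponent_mem_Icc hp hq).1
  set F : ℕ → X → ℝ := fun n x => nlFreg p (ε n) (T n) (y n x) (z n x)
  set F₀ : X → ℝ := fun x => nlF p (y₀ x) (z₀ x)
  have hFQ : ∀ n, MemLp (F n) (ENNReal.ofReal q) μ := fun n =>
    (memLp_nlFreg (hT n) (hεpos n) hp hq (hy n) (hz n)).2
  -- uniform bound in `L^q`
  obtain ⟨D, hD, hFD⟩ : ∃ D : ℝ≥0∞, D ≠ ⊤ ∧ ∀ n, eLpNorm (F n) (ENNReal.ofReal q) μ ≤ D := by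
    set S : ℝ≥0∞ → ℝ≥0∞ := fun c =>
      (ENNReal.ofReal ((3 ^ ((p - 2) / 2)) ^ q) * (μ Set.univ + c)) ^ (1 / q)
    have hS : ∀ c ≠ ⊤, S c ≠ ⊤ := fun c hc =>
      (ENNReal.rpow_lt_top_of_nonneg (by positivity) (by finiteness)).ne
    have hSm : Monotone S := fun a b hab => ENNReal.rpow_le_rpow (by gcongr) (by positivity)
    refine ⟨S C + S (4 * C), ENNReal.add_ne_top.2 ⟨hS _ hC, hS _ (by finiteness)⟩, fun n => ?_⟩
    have h1 : eLpNorm (F n) (ENNReal.ofReal q) μ ≤ _ := eLpNorm_add_le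
      (memLp_regWeight_mul (hT n) (hεpos n) hp (hy n)).1
      (memLp_regWeight_mul (hT n) (hεpos n) hp (hz n)).1
      (by rw [← ENNReal.ofReal_one]; exact ENNReal.ofReal_le_ofReal hq1)
    refine h1.trans (add_le_add ?_ ?_)
    · exact (eLpNorm_regWeight_mul_le (hT n) (hεpos n) (hε1 n) hp hq).trans (hSm (hyC n))
    · refine (eLpNorm_regWeight_mul_le (hT n) (hεpos n) (hε1 n) hp hq).trans (hSm ?_)
      refine (lintegral_modular_le (hT n) (hεpos n) hp hq hB (hy n) (hz n) (hH n)).trans ?_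
      gcongr
      exact hyC n
  -- strong convergence of `z` along a subsequence
  obtain ⟨φ₁, hφ₁, hφ₁lim⟩ := exists_subseq_integral_mul_tendsto hP' hFQ hD hFD
  obtain ⟨w, hw, hwlim⟩ := exists_tendsto_kernel hP' hK (fun n => hFQ (φ₁ n)) hD
    (fun n => hFD (φ₁ n)) hφ₁lim
  have hzw : Tendsto (fun n => eLpNorm (fun x => z (φ₁ n) x + w x) (ENNReal.ofReal p) μ)
      atTop (𝓝 0) := by
    refine hwlim.congr fun n => ?_
    rw [← eLpNorm_neg]
    refine eLpNorm_congr_ae ?_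
    filter_upwards [hH (φ₁ n)] with x hx
    simp only [Pi.neg_apply, F, eq_neg_of_add_eq_zero_left hx]
    ring
  have hw2 : MemLp w 2 μ := hw.mono_exponent hP2
  -- Strong and weak limits agree: testing both with `z₀ + w` yields `∫ (z₀ + w)² = 0`.
  have hz₀w : z₀ =ᵐ[μ] fun x => -w x := by
    have hv : MemLp (fun x => z₀ x + w x) 2 μ := hz₀.add hw2
    have hzw2 : Tendsto (fun n => eLpNorm (fun x => z (φ₁ n) x + w x) 2 μ) atTop (𝓝 0) := by
      have hlim := ENNReal.Tendsto.mul_const (b := μ Set.univ ^ (1 / (2 : ℝ≥0∞).toReal -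
        1 / (ENNReal.ofReal p).toReal)) hzw (Or.inr (by
          refine (ENNReal.rpow_lt_top_of_nonneg ?_ (by finiteness)).ne
          rw [ENNReal.toReal_ofReal (by linarith), ENNReal.toReal_ofNat, sub_nonneg]
          exact one_div_le_one_div_of_le (by norm_num) hp))
      rw [zero_mul] at hlim
      exact tendsto_of_tendsto_of_tendsto_of_le_of_le tendsto_const_nhds hlim
        (fun _ => zero_le) fun n =>
          eLpNorm_le_eLpNorm_mul_rpow_measure_univ hP2 ((hz _).1.add hw.1)
    have hA : Tendsto (fun n => ∫ x, z (φ₁ n) x * (z₀ x + w x) ∂μ) atTop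
        (𝓝 (∫ x, -w x * (z₀ x + w x) ∂μ)) := by
      refine tendsto_integral_of_L1' (fun x => -w x * (z₀ x + w x)) (hw.1.neg.mul hv.1)
        (Eventually.of_forall fun n => (hz _).integrable_mul hv) ?_
      have hlim := ENNReal.Tendsto.mul_const (b := eLpNorm (fun x => z₀ x + w x) 2 μ) hzw2
        (Or.inr hv.2.ne)
      rw [zero_mul] at hlim
      refine tendsto_of_tendsto_of_tendsto_of_le_of_le tendsto_const_nhds hlim
        (fun _ => zero_le) fun n => ?_
      refine le_trans (le_of_eq ?_)
        (eLpNorm_one_mul_le (P := 2) (Q := 2) ((hz (φ₁ n)).1.add hw.1) hv.1)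
      congr 1
      ext x
      simp only [Pi.sub_apply]
      ring
    have hEq := tendsto_nhds_unique hA ((hzlim _ hv).comp hφ₁.tendsto_atTop)
    have i1 : Integrable (fun x => -w x * (z₀ x + w x)) μ := hw2.neg.integrable_mul hv
    have i2 : Integrable (fun x => z₀ x * (z₀ x + w x)) μ := hz₀.integrable_mul hv
    have hsq : ∫ x, (z₀ x + w x) ^ 2 ∂μ = 0 := by
      have : ∫ x, (z₀ x * (z₀ x + w x) - -w x * (z₀ x + w x)) ∂μ = 0 := by
        rw [integral_sub i2 i1, hEq, sub_self]
      rw [← this]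
      exact integral_congr_ae (Eventually.of_forall fun x => by ring)
    rw [integral_eq_zero_iff_of_nonneg (fun x => sq_nonneg _) hv.integrable_sq] at hsq
    filter_upwards [hsq] with x hx
    have : z₀ x + w x = 0 := by simpa using hx
    linarith
  have hzP : Tendsto (fun n => eLpNorm (fun x => z (φ₁ n) x - z₀ x) (ENNReal.ofReal p) μ)
      atTop (𝓝 0) := by
    refine hzw.congr fun n => eLpNorm_congr_ae ?_
    filter_upwards [hz₀w] with x hx
    rw [hx, sub_neg_eq_add]
  have hz₀P : MemLp z₀ (ENNReal.ofReal p) μ := (memLp_congr_ae hz₀w).2 hw.neg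
  -- almost everywhere convergence along a further subsequence
  obtain ⟨φ₂, hφ₂, hzae⟩ := (tendstoInMeasure_of_tendsto_eLpNorm hP0 (fun n => (hz (φ₁ n)).1)
    hz₀P.1 hzP).exists_seq_tendsto_ae
  obtain ⟨φ₃, hφ₃, hyae⟩ := (tendstoInMeasure_of_tendsto_eLpNorm one_ne_zero
    (fun n => (hy (φ₁ (φ₂ n))).1) hy₀
    (hylim.comp (hφ₁.tendsto_atTop.comp hφ₂.tendsto_atTop))).exists_seq_tendsto_ae
  set φ : ℕ → ℕ := fun n => φ₁ (φ₂ (φ₃ n))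
  have hφ : StrictMono φ := hφ₁.comp (hφ₂.comp hφ₃)
  have hzae' : ∀ᵐ x ∂μ, Tendsto (fun n => z (φ n) x) atTop (𝓝 (z₀ x)) := by
    filter_upwards [hzae] with x hx
    exact hx.comp hφ₃.tendsto_atTop
  have hreg : ∀ {s : ℕ → ℝ} {t : ℝ}, Tendsto s atTop (𝓝 t) →
      Tendsto (fun n => regWeight p (ε (φ n)) (T (φ n)) (s n)) atTop (𝓝 (|t| ^ (p - 2))) :=
    fun hs => tendsto_regWeight hp (hε.comp hφ.tendsto_atTop) (hk.comp hφ.tendsto_atTop)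
      (fun n => hT (φ n)) hs
  have hFae : ∀ᵐ x ∂μ, Tendsto (fun n => F (φ n) x) atTop (𝓝 (F₀ x)) := by
    filter_upwards [hzae', hyae] with x hx hx'
    exact ((hreg hx').mul hx').add ((hreg hx).mul hx)
  obtain ⟨hF₀, hFlim⟩ := tendsto_integral_mul_of_ae hP' (fun n => hFQ (φ n)) hD
    (fun n => hFD (φ n)) hFae
  have hy₀P : MemLp y₀ (ENNReal.ofReal p) μ := by
    refine ⟨hy₀, (eLpNorm_lt_top_iff_lintegral_rpow_enorm_lt_top hP0 hP').2 ?_⟩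
    rw [ENNReal.toReal_ofReal (by linarith)]
    refine lt_of_le_of_lt ?_ hC.lt_top
    -- Fatou applies to the regularized modular, whose integrand tends a.e. to `|y₀|^p`.
    calc ∫⁻ x, ‖y₀ x‖ₑ ^ p ∂μ
        = ∫⁻ x, liminf (fun n => ENNReal.ofReal
            (regWeight p (ε (φ n)) (T (φ n)) (y (φ n) x) * y (φ n) x ^ 2)) atTop ∂μ := by
          refine lintegral_congr_ae ?_
          filter_upwards [hyae] with x hx
          have h1 := (ENNReal.tendsto_ofReal ((hreg hx).mul (hx.pow 2))).liminf_eq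
          refine Eq.trans ?_ h1.symm
          rw [enorm_rpow_eq_ofReal _ _ (by linarith)]
          congr 1
          have hpe : p = (p - 2) + (2 : ℕ) := by push_cast; ring
          rcases eq_or_ne (y₀ x) 0 with h0 | h0
          · simp [h0, (by linarith : p ≠ 0)]
          · conv_lhs => rw [hpe, Real.rpow_add (abs_pos.2 h0), Real.rpow_natCast, sq_abs]
      _ ≤ liminf (fun n => ∫⁻ x, ENNReal.ofReal
            (regWeight p (ε (φ n)) (T (φ n)) (y (φ n) x) * y (φ n) x ^ 2) ∂μ) atTop := by
          refine lintegral_liminf_le' fun n => ?_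
          exact ((aestronglyMeasurable_regWeight (hT _) hp (hy _).1).mul
            ((hy _).1.pow 2)).aemeasurable.ennreal_ofReal
      _ ≤ C := liminf_le_of_frequently_le' (Frequently.of_forall fun n => hyC _)
  refine ⟨hy₀P, hz₀P, hF₀, ?_, φ, hφ, hFlim, hzP.comp (hφ₂.comp hφ₃).tendsto_atTop⟩
  -- At almost every `x` the section `K x` is an admissible test function for the weak limit, so the
  -- equation passes to the limit pointwise.
  filter_upwards [(memLp_section_norm hP0 hP' hK).1, hzae', ae_all_iff.2 fun n => hH (φ n)]
    with x hKx hzx hHx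
  have h1 := hFlim _ hKx
  simp only [mul_comm _ (K x _)] at h1
  have h2 := hzx.add h1
  exact tendsto_nhds_unique h2 (tendsto_const_nhds.congr fun n => (hHx n).symm)

end Equation


/-! ### Strong convergence of the states -/

section States

variable {N : ℕ} {Ω : Set (E N)}

lemma lintegral_enorm_le_of_truncPow {F : Type*} [NormedAddCommGroup F] {X : Type*}
    [MeasurableSpace X] {μ : Measure X} {p k : ℝ} (hp : 2 ≤ p) (hk : 1 ≤ k) (u : X → F) :
    ∫⁻ x, ‖u x‖ₑ ∂μ ≤ μ Set.univ + ∫⁻ x, ENNReal.ofReal (truncPow p k ‖u x‖) ∂μ := by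
  have e : μ Set.univ = ∫⁻ _, 1 ∂μ := by simp
  rw [e, ← lintegral_add_left measurable_const]
  refine lintegral_mono fun x => ?_
  rw [← ofReal_norm, ← ENNReal.ofReal_one,
    ← ENNReal.ofReal_add zero_le_one (truncPow_nonneg (by linarith) _)]
  have := abs_le_one_add_truncPow hp hk ‖u x‖
  rw [abs_norm] at this
  exact ENNReal.ofReal_le_ofReal this

/-- Weakly convergent states with uniformly bounded modulars converge in `L¹(Ω)`. -/
lemma tendsto_eLpNorm_val_sub (hΩ : MeasurableSet Ω) (hfin : volume Ω ≠ ⊤) {p : ℝ} (hp : 2 ≤ p)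
    {k : ℕ → ℕ} (hk : ∀ n, 1 ≤ k n) {y : ℕ → H10 Ω} {y₀ : H10 Ω} (hy : WeakTendstoH10 y y₀)
    {M : ℝ≥0∞} (hM : M ≠ ⊤)
    (hgrad : ∀ n, ∫⁻ x in Ω, ENNReal.ofReal (truncPow p (k n) ‖grad (y n) x‖) ≤ M)
    (hval : ∀ n, ∫⁻ x in Ω, ENNReal.ofReal (truncPow p (k n) (val (y n) x)) ≤ M) :
    Tendsto (fun n => eLpNorm (val (y n) - val y₀) 1 (leb Ω)) atTop (𝓝 0) := by
  have hfinm : IsFiniteMeasure (leb Ω) := ⟨by simpa using hfin.lt_top⟩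
  have hk' : ∀ n, (1 : ℝ) ≤ k n := fun n => by exact_mod_cast hk n
  have g0 : ∫⁻ x in Ω, ‖grad y₀ x‖ₑ ≠ ⊤ :=
    ((memLp_grad y₀).integrable (by norm_num)).2.ne
  have v0 : ∫⁻ x in Ω, ‖val y₀ x‖ₑ ≠ ⊤ :=
    ((memLp_val y₀).integrable (by norm_num)).2.ne
  set M' := (leb Ω Set.univ + M) + ((∫⁻ x in Ω, ‖grad y₀ x‖ₑ) + ∫⁻ x in Ω, ‖val y₀ x‖ₑ)
  have hM' : M' ≠ ⊤ := by finiteness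
  have hg : ∀ n, ∫⁻ x in Ω, ‖grad (y n - y₀) x‖ₑ ≤ M' := fun n => by
    calc ∫⁻ x in Ω, ‖grad (y n - y₀) x‖ₑ
        ≤ ∫⁻ x in Ω, (‖grad (y n) x‖ₑ + ‖grad y₀ x‖ₑ) := by
          refine lintegral_mono_ae ?_
          filter_upwards [grad_sub (y n) y₀] with x hx
          rw [hx]
          exact enorm_sub_le
      _ = (∫⁻ x in Ω, ‖grad (y n) x‖ₑ) + ∫⁻ x in Ω, ‖grad y₀ x‖ₑ :=
          lintegral_add_left (stronglyMeasurable_grad _).enorm _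
      _ ≤ M' := by
          refine add_le_add ?_ le_self_add
          refine (lintegral_enorm_le_of_truncPow hp (hk' n) _).trans ?_
          gcongr
          exact hgrad n
  have hv : ∀ n, ∫⁻ x in Ω, ‖val (y n - y₀) x‖ₑ ≤ M' := fun n => by
    calc ∫⁻ x in Ω, ‖val (y n - y₀) x‖ₑ
        ≤ ∫⁻ x in Ω, (‖val (y n) x‖ₑ + ‖val y₀ x‖ₑ) := by
          refine lintegral_mono_ae ?_
          filter_upwards [val_sub (y n) y₀] with x hx
          rw [hx]
          exact enorm_sub_le
      _ = (∫⁻ x in Ω, ‖val (y n) x‖ₑ) + ∫⁻ x in Ω, ‖val y₀ x‖ₑ :=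
          lintegral_add_left (stronglyMeasurable_val _).enorm _
      _ ≤ M' := by
          refine add_le_add ?_ le_add_self
          refine (lintegral_enorm_le_of_truncPow hp (hk' n) _).trans ?_
          simp only [Real.norm_eq_abs, truncPow_abs]
          gcongr
          exact hval n
  refine (tendsto_lintegral_val_zero hΩ hfin hM' hg hv fun v hv => ?_).congr fun n => ?_
  · have h1 := (hy.tendsto_integral hv).sub_const (∫ x in Ω, val y₀ x * v x)
    rw [sub_self] at h1
    refine h1.congr fun n => ?_
    have hi : ∀ u : H10 Ω, Integrable (fun x => val u x * v x) (leb Ω) := fun u =>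
      (memLp_val u).integrable_mul hv
    rw [← integral_sub (hi _) (hi _)]
    refine integral_congr_ae ?_
    filter_upwards [val_sub (y n) y₀] with x hx
    rw [hx, sub_mul]
  · rw [eLpNorm_one_eq_lintegral_enorm]
    refine lintegral_congr_ae ?_
    filter_upwards [val_sub (y n) y₀] with x hx
    rw [hx, Pi.sub_apply]

lemma WeakTendstoH10.comp {y : ℕ → H10 Ω} {y₀ : H10 Ω} (hy : WeakTendstoH10 y y₀) {φ : ℕ → ℕ}
    (hφ : Tendsto φ atTop atTop) : WeakTendstoH10 (fun n => y (φ n)) y₀ :=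
  Tendsto.comp (g := fun n => toWeakSpace ℝ (H10 Ω) (y n)) hy hφ

end States

end Hammerstein

/-! ### Assembly: uniform bounds and convergence of the whole sequence -/

open Hammerstein in
theorem mainTheorem7 {N : ℕ} (hN : 1 ≤ N)
    (Ω : Set (E N)) (hΩ : IsOpen Ω) (hΩb : Bornology.IsBounded Ω)
    (p q : ℝ) (hp : 2 ≤ p) (hq : q = p / (p - 1))
    -- data of the class of admissible controls
    (α γ : ℝ) (hα : 0 < α) (hγ : 0 < γ) (ξ₁ ξ₂ : E N → ℝ)
    (hξ₁ : MemLp ξ₁ ⊤ (leb Ω)) (hξ₁' : MemBV Ω ξ₁)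
    (hξ₂ : MemLp ξ₂ ⊤ (leb Ω)) (hξ₂' : MemBV Ω ξ₂)
    (hξ : ∀ᵐ x ∂(leb Ω), α ≤ ξ₁ x ∧ ξ₁ x ≤ ξ₂ x)
    -- right-hand side, kernel and truncations
    (f : E N → ℝ) (hf : MemLp f 2 (leb Ω))
    (K : E N → E N → ℝ)
    (hK : MemLp (Function.uncurry K) (ENNReal.ofReal p) ((leb Ω).prod (leb Ω)))
    (hB : IsPositiveB Ω q K)
    (T : ℕ → ℝ → ℝ) (hT : ∀ k, IsTruncation k (T k))
    -- the sequence of admissible triplets and its limit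
    (ε : ℕ → ℝ) (hεpos : ∀ n, 0 < ε n) (hε : Tendsto ε atTop (𝓝 0))
    (k : ℕ → ℕ) (hk : Tendsto k atTop atTop)
    (A : ℕ → E N → Matrix (Fin N) (Fin N) ℝ) (y : ℕ → H10 Ω) (z : ℕ → E N → ℝ)
    (hadm : ∀ n, IsAdmissibleTriplet Ω ξ₁ ξ₂ γ p f K (ε n) (T (k n)) (A n) (y n) (z n))
    (A₀ : E N → Matrix (Fin N) (Fin N) ℝ) (hA₀ : MemLinftySym Ω A₀)
    (hA₀' : ∀ᵐ x ∂(leb Ω), (A₀ x).PosSemidef)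
    (y₀ : H10 Ω) (z₀ : E N → ℝ) (hτ : Tau1Tendsto Ω A y z A₀ y₀ z₀) :
    -- `F(y₀, z₀)` is meaningful: `y₀, z₀ ∈ L^p(Ω)`
    MemLp (val y₀) (ENNReal.ofReal p) (leb Ω) ∧ MemLp z₀ (ENNReal.ofReal p) (leb Ω) ∧
    -- `F_{εₙ,kₙ}(yₙ, zₙ) ⇀ F(y₀, z₀)` in `L^q(Ω)`
    WeakTendstoLp (leb Ω) (ENNReal.ofReal q) (ENNReal.ofReal p)
      (fun n x => nlFreg p (ε n) (T (k n)) (val (y n) x) (z n x))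
      (fun x => nlF p (val y₀ x) (z₀ x)) ∧
    -- `z₀ + B F(y₀, z₀) = 0`
    (∀ᵐ x ∂(leb Ω), z₀ x + opB Ω K (fun t => nlF p (val y₀ t) (z₀ t)) x = 0) ∧
    -- `zₙ → z₀` strongly in `L^p(Ω)`
    (∀ n, MemLp (z n) (ENNReal.ofReal p) (leb Ω)) ∧
    Tendsto (fun n => eLpNorm (fun x => z n x - z₀ x) (ENNReal.ofReal p) (leb Ω)) atTop (𝓝 0) := by
  have hfin : volume Ω ≠ ⊤ := hΩb.measure_lt_top.ne
  have hΩm : MeasurableSet Ω := hΩ.measurableSet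
  have hfinm : IsFiniteMeasure (leb Ω) := ⟨by simpa using hfin.lt_top⟩
  have hconj := holderConjugate_ofReal hp hq
  have hP' : ENNReal.ofReal p ≠ ⊤ := ENNReal.ofReal_ne_top
  obtain ⟨C, hC, hCb⟩ := exists_modular_bound (γ := γ) hN hp hα hΩb hξ₂ hξ f
  -- The work `∫ f yₙ` converges by weak convergence of the states, hence is bounded.
  obtain ⟨W, hW⟩ : ∃ W : ℝ, ∀ n, ∫ x in Ω, f x * val (y n) x ≤ W := by
    obtain ⟨W, hW⟩ := (hτ.state.tendsto_integral hf).bddAbove_range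
    exact ⟨W, fun n => by simpa only [mul_comm] using hW ⟨n, rfl⟩⟩
  set M := C * ENNReal.ofReal W
  have hM : M ≠ ⊤ := by finiteness
  have hmod : ∀ n, ∫⁻ x in Ω, ENNReal.ofReal (truncPow p (k n) ‖grad (y n) x‖) ≤ M ∧
      ∫⁻ x in Ω, ENNReal.ofReal (truncPow p (k n) (val (y n) x)) ≤ M := fun n => by
    have h := hCb (k n) (T (k n)) (ε n) (A n) (y n) (hT _) (hεpos n) (hadm n).control
      (hadm n).state
    have hle : C * ENNReal.ofReal (∫ x in Ω, f x * val (y n) x) ≤ M := by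
      simp only [M]
      gcongr
      exact hW n
    exact ⟨h.1.trans hle, h.2.trans hle⟩
  obtain ⟨n₀, hn₀⟩ : ∃ n₀, ∀ n ≥ n₀, ε n ≤ 1 ∧ 1 ≤ k n :=
    eventually_atTop.1 ((hε.eventually_le_const one_pos).and (hk.eventually_ge_atTop 1))
  set M' := ENNReal.ofReal (3 ^ ((p - 2) / 2)) * (leb Ω Set.univ + M)
  have hM' : M' ≠ ⊤ := by finiteness
  -- The compactness result for an arbitrary subsequence beyond `n₀`, where `ε ≤ 1` and `k ≥ 1` make
  -- the constants uniform.
  have key : ∀ ns : ℕ → ℕ, Tendsto ns atTop atTop → (∀ n, n₀ ≤ ns n) → _ := fun ns hns hge =>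
    exists_subseq_hammerstein (μ := leb Ω) hp hq hK hB (hk.comp hns)
      (T := fun n => T (k (ns n))) (fun n => hT _) (ε := fun n => ε (ns n)) (fun n => hεpos _)
      (fun n => (hn₀ _ (hge n)).1) (hε.comp hns) (y := fun n => val (y (ns n)))
      (z := fun n => z (ns n)) (y₀ := val y₀) (z₀ := z₀)
      (fun n => memLp_val _) (fun n => (hadm _).z_memLp) (memLp_val y₀).1 hτ.hammerstein.2.1
      (fun n => (hadm _).hammerstein) hM'
      (fun n => by
        have hkn := (hn₀ _ (hge n)).2
        calc ∫⁻ x in Ω, ENNReal.ofReal (regWeight p (ε (ns n)) (T (k (ns n)))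
              (val (y (ns n)) x) * val (y (ns n)) x ^ 2)
            ≤ ∫⁻ x in Ω, ENNReal.ofReal (3 ^ ((p - 2) / 2)) *
                (1 + ENNReal.ofReal (truncPow p (k (ns n)) (val (y (ns n)) x))) := by
              refine lintegral_mono fun x => ?_
              rw [← ENNReal.ofReal_one, ← ENNReal.ofReal_add zero_le_one
                (truncPow_nonneg (by positivity) _), ← ENNReal.ofReal_mul (by positivity)]
              exact ENNReal.ofReal_le_ofReal
                (regWeight_le_truncPow (hT _) (hεpos _) (hn₀ _ (hge n)).1 hkn hp _)
          _ = ENNReal.ofReal (3 ^ ((p - 2) / 2)) * (leb Ω Set.univ +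
                ∫⁻ x in Ω, ENNReal.ofReal (truncPow p (k (ns n)) (val (y (ns n)) x))) := by
              rw [lintegral_const_mul' _ _ ENNReal.ofReal_ne_top,
                lintegral_add_left measurable_const]
              simp
          _ ≤ M' := by
              simp only [M']
              gcongr
              exact (hmod _).2)
      (tendsto_eLpNorm_val_sub hΩm hfin hp (fun n => (hn₀ _ (hge n)).2) (hτ.state.comp hns) hM
        (fun n => (hmod _).1) (fun n => (hmod _).2))
      (fun v hv => (hτ.hammerstein.2.2 v hv).comp hns)
  have shift : ∀ ns : ℕ → ℕ, Tendsto ns atTop atTop → ∃ m, ∀ n, n₀ ≤ ns (n + m) := fun ns hns => by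
    obtain ⟨m, hm⟩ := eventually_atTop.1 (hns.eventually_ge_atTop n₀)
    exact ⟨m, fun n => hm _ (Nat.le_add_left m n)⟩
  have hadd : ∀ m : ℕ, Tendsto (fun n => n + m) atTop atTop := tendsto_add_atTop_nat
  obtain ⟨hy₀P, hz₀P, hF₀, hlim, -⟩ := key (fun n => n + n₀) (hadd n₀) fun n => Nat.le_add_left _ _
  have hFQ : ∀ n, MemLp (fun x => nlFreg p (ε n) (T (k n)) (val (y n) x) (z n x))
      (ENNReal.ofReal q) (leb Ω) := fun n =>
    (memLp_nlFreg (hT _) (hεpos n) hp hq (memLp_val _) (hadm n).z_memLp).2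
  refine ⟨hy₀P, hz₀P, ⟨hFQ, hF₀, fun v hv => ?_⟩, hlim, fun n => ?_, ?_⟩
  -- Every subsequence has a further one with the same limit. The shift by `m`, which discards
  -- indices below `n₀`, is undone in the witness.
  · refine tendsto_of_subseq_tendsto fun ns hns => ?_
    obtain ⟨m, hm⟩ := shift ns hns
    obtain ⟨-, -, -, -, φ, -, hφF, -⟩ := key (fun n => ns (n + m)) (hns.comp (hadd m)) hm
    exact ⟨fun n => φ n + m, hφF v hv⟩
  -- For each fixed `n` the weight is bounded, so the nonlinearity is in `L²`, hence in `L^q`, and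
  -- `zₙ` is minus its image under `B`.
  · refine (memLp_congr_ae ?_).2 (memLp_kernel hP' hK (hFQ n)).neg
    filter_upwards [(hadm n).hammerstein] with x hx
    exact eq_neg_of_add_eq_zero_left hx
  · refine tendsto_of_subseq_tendsto fun ns hns => ?_
    obtain ⟨m, hm⟩ := shift ns hns
    obtain ⟨-, -, -, -, φ, -, -, hφz⟩ := key (fun n => ns (n + m)) (hns.comp (hadd m)) hm
    exact ⟨fun n => φ n + m, hφz⟩
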